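/- **Calculus.** Formulas are generated by $C,D ::= \eta_n \mid \bot \mid C\wp D \mid C\smallsetminus D$ $(n\in\mathbb N)$. Multiplicative terms are $$M,N ::= x \mid \mathtt y(M)\mid \mathtt{connect\ to}(R)\mid M\wp N\mid \mathtt{casel}(M)\mid\mathtt{caser}(M)\mid\mathtt{mkc}(M,\mathtt y),\qquad P ::= \mathtt{postp}(\mathtt y\mapsto N,M)\mid \mathtt{postp}(M),\qquad R::=M\mid P,$$ where $\mathtt y$ ranges over a countable set of labels, and the free variable of $N$ in $\mathtt{postp}(\mathtt y\mapsto N,M)$ is bound. A typed term in context $x:E\triangleright\kappa:\Gamma$, with $\kappa=\overline P\mid\overline M$, has one variable $x$ of type $E$, a multiset $\overline P$ of $p$-terms, and a list $\overline M$ of $m$-terms of the respective types $\Gamma$. Typed terms are derived, with exchange in $\Gamma$, by the rules below; the labels of different premises are disjoint and each displayed label is fresh. * axiom: $x:A\triangleright\ \mid x:A$; cut: from $x:E\triangleright\kappa:\Gamma,M:A$ and $y:A\triangleright\zeta:\Delta$ infer $x:E\triangleright\kappa:\Gamma,\zeta[y:=M]:\Delta$. * $\bot$: from $x:E\triangleright\kappa:\Gamma$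 and $R\in\kappa$ infer $x:E\triangleright\kappa:\Gamma,\mathtt{connect\ to}(R):\bot$; and $x:\bot\triangleright\mathtt{postp}(x)\mid$. * $\smallsetminus$: from $x:E\triangleright\kappa:\Gamma,M:C$ and $y:D\triangleright\zeta:\Delta$ infer $x:E\triangleright\kappa:\Gamma,\ \zeta[y:=\mathtt y(M)]:\Delta,\ \mathtt{mkc}(M,\mathtt y):C\smallsetminus D$; from $x:E\triangleright\kappa:\Gamma,M:C\smallsetminus D$ and $z:C\triangleright\zeta:\Delta,N:D$ infer $x:E\triangleright\mathtt{postp}(\mathtt z\mapsto N,M),\ \kappa:\Gamma,\ \zeta[z:=\mathtt z(M)]:\Delta$. * $\wp$: from $x:E\triangleright\kappa:\Gamma,M:A,N:B$ infer $x:E\triangleright\kappa:\Gamma,M\wp N:A\wp B$; from $x:E\triangleright\kappa:\Gamma,M:A\wp B$, $y:A\triangleright\zeta:\Delta$ and $z:B\triangleright\xi:\Lambda$ infer $x:E\triangleright\kappa:\Gamma,\ \zeta[y:=\mathtt{casel}\,M]:\Delta,\ \xi[z:=\mathtt{caser}\,M]:\Lambda$. **Equations in context** $x:E\triangleright\kappa=\kappa':\Gamma$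 form the least equivalence relation on the typed terms of each type that is compatible with all these rules (in particular with substitution, i.e. cut) and with injective renaming of labels, and contains, for all typed terms of the kind displayed, * $\kappa,\ \zeta[y:=\mathtt{casel}(M\wp N)],\ \xi[z:=\mathtt{caser}(M\wp N)]\ =\ \kappa,\ \zeta[y:=M],\ \xi[z:=N]$, and $\kappa,\ \mathtt{casel}(M)\wp\mathtt{caser}(M)\ =\ \kappa,\ M$ for $M:A\wp B$; * for $x:E\triangleright\kappa:\Gamma,M:A$, $y:B\triangleright\zeta:\Delta$ and $z:A\triangleright\xi:\Lambda,L:B$, $$\kappa,\ \zeta[y:=\mathtt y(M)],\ \mathtt{postp}(\mathtt z\mapsto L,\mathtt{mkc}(M,\mathtt y)),\ \xi[z:=\mathtt z(\mathtt{mkc}(M,\mathtt y))]\ =\ \kappa,\ \zeta[y:=L[z:=M]],\ \xi[z:=M];$$ * $\kappa,\ \mathtt{mkc}(\mathtt x(M),\mathtt y),\ \mathtt{postp}(\mathtt x\mapsto \mathtt y(x),M)\ =\ \kappa,\ M$ for $M:A\smallsetminus B$; * $\kappa,\ \mathtt{postp}(\mathtt{connect\ to}(R))=\kappa$ for $R\in\kappa$,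 and $\kappa,\ \mathtt{connect\ to}(\mathtt{postp}(M)),\ \mathtt{postp}(M)\ =\ \kappa,\ M$ for $M:\bot$; * (rewiring) $\kappa,\ \mathtt{connect\ to}(R)\ =\ \kappa,\ \mathtt{connect\ to}(R')$ whenever $\kappa:\Gamma$ and both sides $:\Gamma,\bot$ are typed. **Syntactic category.** Its objects are the formulas. A morphism $E\to F$ is a typed term $x:E\triangleright\kappa:F$, modulo renaming of $x$ and derivable equations in context. The identity is $x:E\triangleright x:E$, and composition is cut (with labels renamed apart). A *symmetric monoidal left-closed category* is a symmetric monoidal category in which every functor $A\bullet-$ has a left adjoint $-\smallsetminus A$. **Theorem.** (1) The syntactic category is a symmetric monoidal left-closed category: $A\bullet B=A\wp B$, the unit is $\bot$, and $C\mapsto C\smallsetminus A$ is the object part of a left adjoint of $A\bullet-$. The structure is given by the following terms (of input $x$): * if $f,g$ are the classes of $P\mid M$ and $Q\mid N$, with disjoint labels, then $f\bullet g$ is the class of $P[x:=\mathtt{casel}\,x],\,Q[x:=\mathtt{caser}\,x]\mid M[x:=\mathtt{casel}\,x]\wp N[x:=\mathtt{caser}\,x]$; * $(A\wp B)\wp C\to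 A\wp(B\wp C)$ is $\mathtt{casel}(\mathtt{casel}\,x)\wp(\mathtt{caser}(\mathtt{casel}\,x)\wp\mathtt{caser}\,x)$; * $\bot\wp A\to A$ is $\mathtt{postp}(\mathtt{casel}\,x)\mid\mathtt{caser}\,x$, and $A\wp\bot\to A$ is $\mathtt{postp}(\mathtt{caser}\,x)\mid\mathtt{casel}\,x$; * the symmetry $A\wp B\to B\wp A$ is $\mathtt{caser}\,x\wp\mathtt{casel}\,x$; * the unit $C\to A\wp(C\smallsetminus A)$ of the adjunction is $\mathtt y(x)\wp\mathtt{mkc}(x,\mathtt y)$, and the counit $(A\wp C)\smallsetminus A\to C$ is $\mathtt{postp}(\mathtt z\mapsto\mathtt{casel}\,z,x)\mid\mathtt{caser}(\mathtt z(x))$. (2) (Categorical completeness.) Given a symmetric monoidal left-closed category $\mathbb C$ and objects interpreting the $\eta_n$, interpret $\wp,\bot,\smallsetminus$ by $\bullet,1,\smallsetminus$, a list $\Gamma$ by the $\bullet$-product of its members, and each derivation of $x:E\triangleright\kappa:\Gamma$ by a morphism $[\![E]\!]\to[\![\Gamma]\!]$, by recursion on the derivation: cut is composition, exchange is the symmetry,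 the $\wp$- and $\bot$-introduction rules are the associativity and unit isomorphisms, $\bot$-elimination is $id_1$, $\wp$-elimination is composition with $\bullet$ of the two right premises, and the $\smallsetminus$-rules are given by the unit and the hom-set bijection of the adjunction. If two derivations, of $x:E\triangleright\kappa:\Gamma$ and of $x:E\triangleright\kappa':\Gamma$, have equal interpretations in every small symmetric monoidal left-closed category for every choice of objects for the $\eta_n$, then the equation in context $x:E\triangleright\kappa=\kappa':\Gamma$ is derivable. -/

import Mathlib

open CategoryTheory MonoidalCategory

namespace CoILL

/-! ### Formulas and terms -/

/-- Formulas of multiplicative co-intuitionistic linear logic.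
`sub C D` is the subtraction `C ∖ D`. -/
inductive Formula : Type
  | atom (n : ℕ) : Formula
  | bot : Formula
  | par (A B : Formula) : Formula
  | sub (C D : Formula) : Formula

/-- The two sorts of terms: `m`-terms (they are assigned to the formulas of a succedent) and
`p`-terms (they are kept in the control area). -/
inductive Srt : Type
  | m : Srt
  | p : Srt

/-- Multiplicative terms. A typed term in context has exactly one free variable, and terms in
context are taken modulo renaming of it, so the only free variable is the nameless `var`.
The unary functions (the labels that record remote binding) are named by natural numbers:
`app y M` is `y(M)`, and `mkc M y` is `mkc(M, y)`. In `postpone y N M`, which is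
`postp(y ↦ N, M)`, the term `N` has its own locally bound variable, again written `var`
inside `N`, and no other free variable. The empty term is the empty control area. -/
inductive Tm : Srt → Type
  | var : Tm .m
  | app (y : ℕ) (M : Tm .m) : Tm .m
  | conn {s : Srt} (R : Tm s) : Tm .m
  | par (M N : Tm .m) : Tm .m
  | casel (M : Tm .m) : Tm .m
  | caser (M : Tm .m) : Tm .m
  | mkc (M : Tm .m) (y : ℕ) : Tm .m
  | postpone (y : ℕ) (N M : Tm .m) : Tm .p
  | postp (M : Tm .m) : Tm .p

/-- Substitution `R[x := T]` for the free variable. -/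
def Tm.subst : {s : Srt} → Tm s → Tm .m → Tm s
  | _, .var, T => T
  | _, .app y M, T => .app y (M.subst T)
  | _, .conn R, T => .conn (R.subst T)
  | _, .par M N, T => .par (M.subst T) (N.subst T)
  | _, .casel M, T => .casel (M.subst T)
  | _, .caser M, T => .caser (M.subst T)
  | _, .mkc M y, T => .mkc (M.subst T) y
  | _, .postpone y N M, T => .postpone y N (M.subst T)
  | _, .postp M, T => .postp (M.subst T)

/-- The labels (unary functions) that occur in a term. -/
def Tm.labels : {s : Srt} → Tm s → Set ℕ
  | _, .var => ∅
  | _, .app y M => insert y M.labels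
  | _, .conn R => R.labels
  | _, .par M N => M.labels ∪ N.labels
  | _, .casel M => M.labels
  | _, .caser M => M.labels
  | _, .mkc M y => insert y M.labels
  | _, .postpone y N M => insert y (N.labels ∪ M.labels)
  | _, .postp M => M.labels

/-- Renaming of labels. -/
def Tm.rename (f : ℕ → ℕ) : {s : Srt} → Tm s → Tm s
  | _, .var => .var
  | _, .app y M => .app (f y) (M.rename f)
  | _, .conn R => .conn (R.rename f)
  | _, .par M N => .par (M.rename f) (N.rename f)
  | _, .casel M => .casel (M.rename f)
  | _, .caser M => .caser (M.rename f)
  | _, .mkc M y => .mkc (M.rename f) (f y)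
  | _, .postpone y N M => .postpone (f y) (N.rename f) (M.rename f)
  | _, .postp M => .postp (M.rename f)

/-! ### Contexts of terms -/

/-- A context `P₁, …, Pₖ | M₁, …, Mₙ`: the `p`-terms of the control area (parallel composition
is associative and commutative) and the list of `m`-terms that are assigned, in order, to the
formulas of the succedent. -/
@[ext]
structure Cx : Type where
  ctrl : Multiset (Tm .p)
  tms : List (Tm .m)

namespace Cx

/-- Add an `m`-term at the head: with `κ : Γ` this gives `κ.cons M : A, Γ`. -/
def cons (κ : Cx) (M : Tm .m) : Cx := ⟨κ.ctrl, M :: κ.tms⟩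

/-- Add a `p`-term to the control area. -/
def addCtrl (κ : Cx) (P : Tm .p) : Cx := ⟨P ::ₘ κ.ctrl, κ.tms⟩

/-- Juxtaposition: `κ : Γ` and `ζ : Δ` give `κ ++ ζ : Γ, Δ`. -/
instance : Append Cx := ⟨fun κ ζ => ⟨κ.ctrl + ζ.ctrl, κ.tms ++ ζ.tms⟩⟩

/-- `κ[x := T]`. -/
def subst (κ : Cx) (T : Tm .m) : Cx :=
  ⟨κ.ctrl.map fun P => P.subst T, κ.tms.map fun M => M.subst T⟩

def labels (κ : Cx) : Set ℕ :=
  {n | (∃ P ∈ κ.ctrl, n ∈ P.labels) ∨ ∃ M ∈ κ.tms, n ∈ M.labels}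

def rename (f : ℕ → ℕ) (κ : Cx) : Cx :=
  ⟨κ.ctrl.map fun P => P.rename f, κ.tms.map fun M => M.rename f⟩

/-- `R ∈ κ`, for an `m`-term or a `p`-term `R`. -/
def Mem (κ : Cx) : {s : Srt} → Tm s → Prop
  | .m, R => R ∈ κ.tms
  | .p, R => R ∈ κ.ctrl

end Cx

/-- No label occurs both in `κ` and in `ζ`. -/
def Apart (κ ζ : Cx) : Prop := Disjoint κ.labels ζ.labels

/-- The label `y` does not occur in `κ`. -/
def Fresh (y : ℕ) (κ : Cx) : Prop := y ∉ κ.labels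

/-! ### Typing -/

/-- `Der E κ Γ` is the type of derivations of the typed term in context `x : E ▷ κ : Γ` in the
decorated natural deduction system. The active formula of a rule is written at the head of the
succedent, and the exchange rule is explicit. The conditions on labels are the usual variable
convention: distinct binders carry distinct labels. -/
inductive Der : Formula → Cx → List Formula → Type
  | ax (A : Formula) : Der A ⟨0, [.var]⟩ [A]
  | exch {E : Formula} {P : Multiset (Tm .p)} {Ms Ns : List (Tm .m)} {M N : Tm .m}
      {Γ Δ : List Formula} {A B : Formula} (hlen : Ms.length = Γ.length)
      (d : Der E ⟨P, Ms ++ M :: N :: Ns⟩ (Γ ++ A :: B :: Δ)) :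
      Der E ⟨P, Ms ++ N :: M :: Ns⟩ (Γ ++ B :: A :: Δ)
  | cut {E A : Formula} {κ ζ : Cx} {M : Tm .m} {Γ Δ : List Formula}
      (d : Der E (κ.cons M) (A :: Γ)) (e : Der A ζ Δ) (h : Apart (κ.cons M) ζ) :
      Der E (ζ.subst M ++ κ) (Δ ++ Γ)
  | botI {E : Formula} {κ : Cx} {Γ : List Formula} {s : Srt} {R : Tm s}
      (d : Der E κ Γ) (hR : κ.Mem R) :
      Der E (κ.cons (.conn R)) (.bot :: Γ)
  | botE : Der .bot ⟨{.postp .var}, []⟩ []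
  | subI {E C D : Formula} {κ ζ : Cx} {M : Tm .m} {Γ Δ : List Formula} (y : ℕ)
      (d : Der E (κ.cons M) (C :: Γ)) (e : Der D ζ Δ)
      (h : Apart (κ.cons M) ζ) (hy : Fresh y (κ.cons M)) (hy' : Fresh y ζ) :
      Der E ((ζ.subst (.app y M) ++ κ).cons (.mkc M y)) (.sub C D :: (Δ ++ Γ))
  | subE {E C D : Formula} {κ ζ : Cx} {M N : Tm .m} {Γ Δ : List Formula} (x : ℕ)
      (d : Der E (κ.cons M) (.sub C D :: Γ)) (e : Der C (ζ.cons N) (D :: Δ))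
      (h : Apart (κ.cons M) (ζ.cons N)) (hx : Fresh x (κ.cons M)) (hx' : Fresh x (ζ.cons N)) :
      Der E ((ζ.subst (.app x M) ++ κ).addCtrl (.postpone x N M)) (Δ ++ Γ)
  | parI {E A B : Formula} {κ : Cx} {M N : Tm .m} {Γ : List Formula}
      (d : Der E ((κ.cons N).cons M) (A :: B :: Γ)) :
      Der E (κ.cons (.par M N)) (.par A B :: Γ)
  | parE {E A B : Formula} {κ ζ ξ : Cx} {M : Tm .m} {Γ Δ Λ : List Formula}
      (d : Der E (κ.cons M) (.par A B :: Γ)) (e : Der A ζ Δ) (e' : Der B ξ Λ)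
      (h₁ : Apart (κ.cons M) ζ) (h₂ : Apart (κ.cons M) ξ) (h₃ : Apart ζ ξ) :
      Der E (ζ.subst (.casel M) ++ (ξ.subst (.caser M) ++ κ)) (Δ ++ (Λ ++ Γ))

/-- `x : E ▷ κ : Γ` is derivable. -/
def Typed (E : Formula) (κ : Cx) (Γ : List Formula) : Prop := Nonempty (Der E κ Γ)

/-! ### Equations in context -/

/-- `Eqn E κ κ' Γ` is the equation in context `x : E ▷ κ = κ' : Γ`. It is generated by
reflexivity, symmetry, transitivity, substitution and compatibility with the term formers,
by renaming of labels, and by the `β` and `η` equations for par, subtraction and the unit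
together with the rewiring equations for the unit. -/
inductive Eqn : Formula → Cx → Cx → List Formula → Prop
  | refl {E : Formula} {κ : Cx} {Γ : List Formula} (h : Typed E κ Γ) : Eqn E κ κ Γ
  | symm {E : Formula} {κ κ' : Cx} {Γ : List Formula} (h : Eqn E κ κ' Γ) : Eqn E κ' κ Γ
  | trans {E : Formula} {κ κ' κ'' : Cx} {Γ : List Formula}
      (h : Eqn E κ κ' Γ) (h' : Eqn E κ' κ'' Γ) : Eqn E κ κ'' Γ
  | subst {E A : Formula} {κ κ' ζ ζ' : Cx} {M M' : Tm .m} {Γ Δ : List Formula}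
      (h : Eqn E (κ.cons M) (κ'.cons M') (A :: Γ)) (k : Eqn A ζ ζ' Δ)
      (a : Apart (κ.cons M) ζ) (a' : Apart (κ'.cons M') ζ') :
      Eqn E (ζ.subst M ++ κ) (ζ'.subst M' ++ κ') (Δ ++ Γ)
  | exch {E : Formula} {P P' : Multiset (Tm .p)} {Ms Ns Ms' Ns' : List (Tm .m)}
      {M N M' N' : Tm .m} {Γ Δ : List Formula} {A B : Formula}
      (hlen : Ms.length = Γ.length) (hlen' : Ms'.length = Γ.length)
      (h : Eqn E ⟨P, Ms ++ M :: N :: Ns⟩ ⟨P', Ms' ++ M' :: N' :: Ns'⟩ (Γ ++ A :: B :: Δ)) :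
      Eqn E ⟨P, Ms ++ N :: M :: Ns⟩ ⟨P', Ms' ++ N' :: M' :: Ns'⟩ (Γ ++ B :: A :: Δ)
  | botI {E : Formula} {κ κ' : Cx} {Γ : List Formula} {s s' : Srt} {R : Tm s} {R' : Tm s'}
      (h : Eqn E κ κ' Γ) (hR : κ.Mem R) (hR' : κ'.Mem R') :
      Eqn E (κ.cons (.conn R)) (κ'.cons (.conn R')) (.bot :: Γ)
  | subI {E C D : Formula} {κ κ' ζ ζ' : Cx} {M M' : Tm .m} {Γ Δ : List Formula} (y : ℕ)
      (h : Eqn E (κ.cons M) (κ'.cons M') (C :: Γ)) (k : Eqn D ζ ζ' Δ)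
      (a : Apart (κ.cons M) ζ) (a' : Apart (κ'.cons M') ζ')
      (hy₁ : Fresh y (κ.cons M)) (hy₂ : Fresh y ζ)
      (hy₃ : Fresh y (κ'.cons M')) (hy₄ : Fresh y ζ') :
      Eqn E ((ζ.subst (.app y M) ++ κ).cons (.mkc M y))
        ((ζ'.subst (.app y M') ++ κ').cons (.mkc M' y)) (.sub C D :: (Δ ++ Γ))
  | subE {E C D : Formula} {κ κ' ζ ζ' : Cx} {M M' N N' : Tm .m} {Γ Δ : List Formula} (x : ℕ)
      (h : Eqn E (κ.cons M) (κ'.cons M') (.sub C D :: Γ))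
      (k : Eqn C (ζ.cons N) (ζ'.cons N') (D :: Δ))
      (a : Apart (κ.cons M) (ζ.cons N)) (a' : Apart (κ'.cons M') (ζ'.cons N'))
      (hx₁ : Fresh x (κ.cons M)) (hx₂ : Fresh x (ζ.cons N))
      (hx₃ : Fresh x (κ'.cons M')) (hx₄ : Fresh x (ζ'.cons N')) :
      Eqn E ((ζ.subst (.app x M) ++ κ).addCtrl (.postpone x N M))
        ((ζ'.subst (.app x M') ++ κ').addCtrl (.postpone x N' M')) (Δ ++ Γ)
  | parI {E A B : Formula} {κ κ' : Cx} {M N M' N' : Tm .m} {Γ : List Formula}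
      (h : Eqn E ((κ.cons N).cons M) ((κ'.cons N').cons M') (A :: B :: Γ)) :
      Eqn E (κ.cons (.par M N)) (κ'.cons (.par M' N')) (.par A B :: Γ)
  | parE {E A B : Formula} {κ κ' ζ ζ' ξ ξ' : Cx} {M M' : Tm .m} {Γ Δ Λ : List Formula}
      (h : Eqn E (κ.cons M) (κ'.cons M') (.par A B :: Γ))
      (k : Eqn A ζ ζ' Δ) (l : Eqn B ξ ξ' Λ)
      (a₁ : Apart (κ.cons M) ζ) (a₂ : Apart (κ.cons M) ξ) (a₃ : Apart ζ ξ)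
      (a₁' : Apart (κ'.cons M') ζ') (a₂' : Apart (κ'.cons M') ξ') (a₃' : Apart ζ' ξ') :
      Eqn E (ζ.subst (.casel M) ++ (ξ.subst (.caser M) ++ κ))
        (ζ'.subst (.casel M') ++ (ξ'.subst (.caser M') ++ κ')) (Δ ++ (Λ ++ Γ))
  /- renaming of labels -/
  | alpha {E : Formula} {κ : Cx} {Γ : List Formula} (f : ℕ → ℕ) (hf : Function.Injective f)
      (h : Typed E κ Γ) : Eqn E κ (κ.rename f) Γ
  /- `casel(M ⅋ N) = M` and `caser(M ⅋ N) = N` in context -/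
  | parBeta {E A B : Formula} {κ ζ ξ : Cx} {M N : Tm .m} {Γ Δ Λ : List Formula}
      (h : Typed E ((κ.cons N).cons M) (A :: B :: Γ)) (k : Typed A ζ Δ) (l : Typed B ξ Λ)
      (a₁ : Apart ((κ.cons N).cons M) ζ) (a₂ : Apart ((κ.cons N).cons M) ξ) (a₃ : Apart ζ ξ) :
      Eqn E (ζ.subst (.casel (.par M N)) ++ (ξ.subst (.caser (.par M N)) ++ κ))
        (ζ.subst M ++ (ξ.subst N ++ κ)) (Δ ++ (Λ ++ Γ))
  /- `casel(M) ⅋ caser(M) = M` in context -/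
  | parEta {E A B : Formula} {κ : Cx} {M : Tm .m} {Γ : List Formula}
      (h : Typed E (κ.cons M) (.par A B :: Γ)) :
      Eqn E (κ.cons (.par (.casel M) (.caser M))) (κ.cons M) (.par A B :: Γ)
  /- removal of the redex `postp(z ↦ L, mkc(M, y))`: then `z` becomes `M` and
     `y` becomes `L[z := M]` -/
  | subBeta {E A B : Formula} {κ ζ ξ : Cx} {M L : Tm .m} {Γ Δ Λ : List Formula} (y z : ℕ)
      (h : Typed E (κ.cons M) (A :: Γ)) (k : Typed B ζ Δ) (l : Typed A (ξ.cons L) (B :: Λ))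
      (a₁ : Apart (κ.cons M) ζ) (a₂ : Apart (κ.cons M) (ξ.cons L)) (a₃ : Apart ζ (ξ.cons L))
      (hyz : y ≠ z) (hy₁ : Fresh y (κ.cons M)) (hy₂ : Fresh y ζ) (hy₃ : Fresh y (ξ.cons L))
      (hz₁ : Fresh z (κ.cons M)) (hz₂ : Fresh z ζ) (hz₃ : Fresh z (ξ.cons L)) :
      Eqn E ((ξ.subst (.app z (.mkc M y)) ++ (ζ.subst (.app y M) ++ κ)).addCtrl
          (.postpone z L (.mkc M y)))
        (ξ.subst M ++ (ζ.subst (L.subst M) ++ κ)) (Λ ++ (Δ ++ Γ))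
  /- `mkc(x(M), y) ‖ postp(x ↦ y(x), M) = M` in context -/
  | subEta {E A B : Formula} {κ : Cx} {M : Tm .m} {Γ : List Formula} (x y : ℕ)
      (h : Typed E (κ.cons M) (.sub A B :: Γ))
      (hxy : x ≠ y) (hx : Fresh x (κ.cons M)) (hy : Fresh y (κ.cons M)) :
      Eqn E ((κ.cons (.mkc (.app x M) y)).addCtrl (.postpone x (.app y .var) M))
        (κ.cons M) (.sub A B :: Γ)
  /- rewiring: `connect to(R)` may be moved to any other term to which it may be attached,
     in `κ` itself or in a context from which `κ` is obtained -/
  | rewire {E : Formula} {κ : Cx} {Γ : List Formula} {s s' : Srt} {R : Tm s} {R' : Tm s'}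
      (h : Typed E κ Γ) (k : Typed E (κ.cons (.conn R)) (.bot :: Γ))
      (k' : Typed E (κ.cons (.conn R')) (.bot :: Γ)) :
      Eqn E (κ.cons (.conn R)) (κ.cons (.conn R')) (.bot :: Γ)
  /- `postp(connect to(R)) = []` in context -/
  | botBeta {E : Formula} {κ : Cx} {Γ : List Formula} {s : Srt} {R : Tm s}
      (h : Typed E κ Γ) (hR : κ.Mem R) :
      Eqn E (κ.addCtrl (.postp (.conn R))) κ Γ
  /- `connect to(postp(M)) ‖ postp(M) = M` in context -/
  | botEta {E : Formula} {κ : Cx} {M : Tm .m} {Γ : List Formula}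
      (h : Typed E (κ.cons M) (.bot :: Γ)) :
      Eqn E ((κ.cons (.conn (Tm.postp M))).addCtrl (.postp M)) (κ.cons M) (.bot :: Γ)

/-! ### Facts that make composition well defined -/

theorem Tm.rename_subst (f : ℕ → ℕ) {s : Srt} (R : Tm s) (T : Tm .m) :
    (R.subst T).rename f = (R.rename f).subst (T.rename f) := by
  induction R <;> simp_all [Tm.subst, Tm.rename]

theorem Tm.labels_rename (f : ℕ → ℕ) {s : Srt} (R : Tm s) :
    (R.rename f).labels = f '' R.labels := by
  induction R <;> simp_all [Tm.labels, Tm.rename, Set.image_insert_eq, Set.image_union]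

theorem Tm.rename_rename (f g : ℕ → ℕ) {s : Srt} (R : Tm s) :
    (R.rename f).rename g = R.rename (g ∘ f) := by
  induction R <;> simp_all [Tm.rename]

theorem Tm.subst_var {s : Srt} (R : Tm s) : R.subst .var = R := by
  induction R <;> simp_all [Tm.subst]

theorem Tm.subst_subst {s : Srt} (R : Tm s) (T U : Tm .m) :
    (R.subst T).subst U = R.subst (T.subst U) := by
  induction R <;> simp_all [Tm.subst]

namespace Cx

theorem rename_cons (f : ℕ → ℕ) (κ : Cx) (M : Tm .m) :
    (κ.cons M).rename f = (κ.rename f).cons (M.rename f) := rfl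

theorem rename_addCtrl (f : ℕ → ℕ) (κ : Cx) (P : Tm .p) :
    (κ.addCtrl P).rename f = (κ.rename f).addCtrl (P.rename f) := by
  simp [addCtrl, rename]

theorem append_def (κ ζ : Cx) : κ ++ ζ = ⟨κ.ctrl + ζ.ctrl, κ.tms ++ ζ.tms⟩ := rfl

theorem rename_append (f : ℕ → ℕ) (κ ζ : Cx) :
    (κ ++ ζ).rename f = κ.rename f ++ ζ.rename f := by
  simp [append_def, rename]

theorem rename_subst (f : ℕ → ℕ) (κ : Cx) (T : Tm .m) :
    (κ.subst T).rename f = (κ.rename f).subst (T.rename f) := by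
  simp [subst, rename, Tm.rename_subst]

theorem labels_rename (f : ℕ → ℕ) (κ : Cx) : (κ.rename f).labels = f '' κ.labels := by
  ext n
  simp only [labels, rename, Multiset.mem_map, List.mem_map, Set.mem_ofPred_eq, Set.mem_image]
  constructor
  · rintro (⟨_, ⟨P, hP, rfl⟩, hn⟩ | ⟨_, ⟨M, hM, rfl⟩, hn⟩)
    · rw [Tm.labels_rename] at hn
      obtain ⟨k, hk, rfl⟩ := hn
      exact ⟨k, Or.inl ⟨P, hP, hk⟩, rfl⟩
    · rw [Tm.labels_rename] at hn
      obtain ⟨k, hk, rfl⟩ := hn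
      exact ⟨k, Or.inr ⟨M, hM, hk⟩, rfl⟩
  · rintro ⟨k, ⟨P, hP, hk⟩ | ⟨M, hM, hk⟩, rfl⟩
    · exact Or.inl ⟨_, ⟨P, hP, rfl⟩, by rw [Tm.labels_rename]; exact ⟨k, hk, rfl⟩⟩
    · exact Or.inr ⟨_, ⟨M, hM, rfl⟩, by rw [Tm.labels_rename]; exact ⟨k, hk, rfl⟩⟩

theorem rename_rename (f g : ℕ → ℕ) (κ : Cx) :
    (κ.rename f).rename g = κ.rename (g ∘ f) := by
  simp [rename, Tm.rename_rename, Function.comp_def]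

theorem subst_var (κ : Cx) : κ.subst .var = κ := by
  simp [subst, Tm.subst_var]

theorem subst_subst (κ : Cx) (T U : Tm .m) :
    (κ.subst T).subst U = κ.subst (T.subst U) := by
  simp [subst, Tm.subst_subst, Function.comp_def]

theorem mem_rename (f : ℕ → ℕ) (κ : Cx) {s : Srt} {R : Tm s} (h : κ.Mem R) :
    (κ.rename f).Mem (R.rename f) := by
  cases s
  · exact List.mem_map_of_mem h
  · exact Multiset.mem_map_of_mem _ h

end Cx

theorem Apart.rename {f : ℕ → ℕ} (hf : Function.Injective f) {κ ζ : Cx} (h : Apart κ ζ) :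
    Apart (κ.rename f) (ζ.rename f) := by
  unfold Apart
  rw [Cx.labels_rename, Cx.labels_rename]
  exact (Set.disjoint_image_iff hf).2 h

theorem Fresh.rename {f : ℕ → ℕ} (hf : Function.Injective f) {y : ℕ} {κ : Cx}
    (h : Fresh y κ) : Fresh (f y) (κ.rename f) := by
  unfold Fresh
  rw [Cx.labels_rename, hf.mem_set_image]
  exact h

/-- Derivability is stable under injective renaming of labels. -/
theorem Typed.rename {f : ℕ → ℕ} (hf : Function.Injective f) {E : Formula} {κ : Cx}
    {Γ : List Formula} (h : Typed E κ Γ) : Typed E (κ.rename f) Γ := by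
  obtain ⟨d⟩ := h
  induction d with
  | ax A => exact ⟨Der.ax A⟩
  | exch hlen d ih =>
    obtain ⟨d⟩ := ih
    simp only [Cx.rename, List.map_append, List.map_cons] at d ⊢
    exact ⟨Der.exch (by simpa using hlen) d⟩
  | cut d e h ihd ihe =>
    obtain ⟨d⟩ := ihd
    obtain ⟨e⟩ := ihe
    rw [Cx.rename_append, Cx.rename_subst]
    exact ⟨Der.cut d e (h.rename hf)⟩
  | botI d hR ih =>
    obtain ⟨d⟩ := ih
    exact ⟨Der.botI d (Cx.mem_rename f _ hR)⟩
  | botE => exact ⟨Der.botE⟩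
  | subI y d e h hy hy' ihd ihe =>
    obtain ⟨d⟩ := ihd
    obtain ⟨e⟩ := ihe
    rw [Cx.rename_cons, Cx.rename_append, Cx.rename_subst]
    exact ⟨Der.subI (f y) d e (h.rename hf) (hy.rename hf) (hy'.rename hf)⟩
  | subE x d e h hx hx' ihd ihe =>
    obtain ⟨d⟩ := ihd
    obtain ⟨e⟩ := ihe
    rw [Cx.rename_addCtrl, Cx.rename_append, Cx.rename_subst]
    exact ⟨Der.subE (f x) d e (h.rename hf) (hx.rename hf) (hx'.rename hf)⟩
  | parI d ih =>
    obtain ⟨d⟩ := ih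
    rw [Cx.rename_cons]
    exact ⟨Der.parI d⟩
  | parE d e e' h₁ h₂ h₃ ihd ihe ihe' =>
    obtain ⟨d⟩ := ihd
    obtain ⟨e⟩ := ihe
    obtain ⟨e'⟩ := ihe'
    rw [Cx.rename_append, Cx.rename_append, Cx.rename_subst, Cx.rename_subst]
    exact ⟨Der.parE d e e' (h₁.rename hf) (h₂.rename hf) (h₃.rename hf)⟩

/-- Derivable contexts assign one `m`-term to each formula of the succedent. -/
theorem Typed.length {E : Formula} {κ : Cx} {Γ : List Formula} (h : Typed E κ Γ) :
    κ.tms.length = Γ.length := by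
  obtain ⟨d⟩ := h
  induction d <;> simp_all [Cx.cons, Cx.addCtrl, Cx.subst, Cx.append_def]

theorem Eqn.rename {f : ℕ → ℕ} (hf : Function.Injective f) {E : Formula} {κ κ' : Cx}
    {Γ : List Formula} (h : Eqn E κ κ' Γ) (t : Typed E κ Γ) (t' : Typed E κ' Γ) :
    Eqn E (κ.rename f) (κ'.rename f) Γ :=
  ((Eqn.alpha f hf t).symm.trans h).trans (Eqn.alpha f hf t')

/-! ### The syntactic category -/

/-- A typed term in context `x : E ▷ κ : F` with one conclusion. -/
def TermIn (E F : Formula) : Type := {κ : Cx // Typed E κ [F]}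

instance termSetoid (E F : Formula) : Setoid (TermIn E F) where
  r κ ζ := Eqn E κ.1 ζ.1 [F]
  iseqv := ⟨fun κ => Eqn.refl κ.2, Eqn.symm, Eqn.trans⟩

/-- Morphisms `E ⟶ F` of the syntactic category: typed terms in context modulo derivable
equations in context. -/
def Mor (E F : Formula) : Type := Quotient (termSetoid E F)

/-- The `m`-term of a context with one conclusion. -/
def Cx.out (κ : Cx) : Tm .m := κ.tms.headD .var

/-- The result `P, Q[y := M] | N[y := M]` of cutting `P | M` with `ζ = Q | N`. -/
def Cx.comp (κ ζ : Cx) : Cx := ζ.subst κ.out ++ (⟨κ.ctrl, []⟩ : Cx)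

theorem Typed.eq_cons {E F : Formula} {κ : Cx} (h : Typed E κ [F]) :
    κ = (⟨κ.ctrl, []⟩ : Cx).cons κ.out := by
  have := h.length
  obtain ⟨P, Ms⟩ := κ
  match Ms, this with
  | [M], _ => rfl

theorem Typed.comp {E F G : Formula} {κ ζ : Cx} (h : Typed E κ [F]) (k : Typed F ζ [G])
    (a : Apart κ ζ) : Typed E (κ.comp ζ) [G] := by
  have e := h.eq_cons
  rw [e] at h a
  obtain ⟨d⟩ := h
  obtain ⟨d'⟩ := k
  exact ⟨Der.cut d d' a⟩

theorem Eqn.comp {E F G : Formula} {κ κ' ζ ζ' : Cx} (h : Eqn E κ κ' [F]) (k : Eqn F ζ ζ' [G])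
    (t : Typed E κ [F]) (t' : Typed E κ' [F]) (a : Apart κ ζ) (a' : Apart κ' ζ') :
    Eqn E (κ.comp ζ) (κ'.comp ζ') [G] := by
  have e := t.eq_cons
  have e' := t'.eq_cons
  rw [e] at a
  rw [e'] at a'
  rw [e, e'] at h
  exact Eqn.subst h k a a'

/-- Labels of the left factor of a composite are made even, those of the right factor odd. -/
def evenL (n : ℕ) : ℕ := 2 * n

def oddL (n : ℕ) : ℕ := 2 * n + 1

theorem evenL_injective : Function.Injective evenL := fun a b h => by
  simp only [evenL] at h; omega

theorem oddL_injective : Function.Injective oddL := fun a b h => by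
  simp only [oddL] at h; omega

theorem apart_even_odd (κ ζ : Cx) : Apart (κ.rename evenL) (ζ.rename oddL) := by
  unfold Apart
  rw [Cx.labels_rename, Cx.labels_rename, Set.disjoint_left]
  rintro _ ⟨a, _, rfl⟩ ⟨b, _, h⟩
  simp only [evenL, oddL] at h; omega

/-- Identity `x : E ▷ x : E`. -/
def Mor.id (E : Formula) : Mor E E := Quotient.mk _ ⟨⟨0, [.var]⟩, ⟨Der.ax E⟩⟩

/-- Composition is cut, after the labels of the two contexts have been renamed apart. -/
def Mor.comp {E F G : Formula} (f : Mor E F) (g : Mor F G) : Mor E G :=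
  Quotient.map₂
    (fun κ ζ => (⟨(κ.1.rename evenL).comp (ζ.1.rename oddL),
      (κ.2.rename evenL_injective).comp (ζ.2.rename oddL_injective) (apart_even_odd _ _)⟩ :
        TermIn E G))
    (fun κ κ' h ζ ζ' k =>
      Eqn.comp (Eqn.rename evenL_injective h κ.2 κ'.2) (Eqn.rename oddL_injective k ζ.2 ζ'.2)
        (κ.2.rename evenL_injective) (κ'.2.rename evenL_injective)
        (apart_even_odd _ _) (apart_even_odd _ _)) f g

theorem Cx.rename_comp (f : ℕ → ℕ) {E F : Formula} {κ ζ : Cx} (h : Typed E κ [F]) :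
    (κ.comp ζ).rename f = (κ.rename f).comp (ζ.rename f) := by
  rw [h.eq_cons, Cx.rename_cons]
  unfold Cx.comp
  rw [Cx.rename_append, Cx.rename_subst]
  rfl

theorem Cx.comp_assoc {E F G : Formula} {κ ζ : Cx} (ξ : Cx) (h : Typed E κ [F])
    (k : Typed F ζ [G]) : (κ.comp ζ).comp ξ = κ.comp (ζ.comp ξ) := by
  rw [h.eq_cons, k.eq_cons]
  simp [Cx.comp, Cx.append_def, Cx.subst, Cx.out, Cx.cons, Tm.subst_subst, Function.comp_def,
    add_assoc]

/-- An injective relabelling that relates the two ways of renaming three contexts apart. -/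
def assocL (n : ℕ) : ℕ :=
  if n % 2 = 1 then 2 * n + 1 else if n % 4 = 0 then n / 2 else n - 1

theorem assocL_injective : Function.Injective assocL := fun a b h => by
  simp only [assocL] at h
  split_ifs at h <;> omega

/-- The syntactic category: its objects are the formulas, its morphisms are typed terms modulo
equations in context. -/
instance : Category.{0} Formula where
  Hom := Mor
  id := Mor.id
  comp := Mor.comp
  id_comp {E F} f := by
    induction f using Quotient.inductionOn with | _ κ =>
    refine Quotient.sound ?_
    have e : ((⟨0, [.var]⟩ : Cx).rename evenL).comp (κ.1.rename oddL) = κ.1.rename oddL := by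
      simp [Cx.comp, Cx.rename, Cx.out, Cx.subst, Cx.append_def, Tm.rename, Tm.subst_var]
    change Eqn E (((⟨0, [.var]⟩ : Cx).rename evenL).comp (κ.1.rename oddL)) κ.1 [F]
    rw [e]
    exact (Eqn.alpha _ oddL_injective κ.2).symm
  comp_id {E F} f := by
    induction f using Quotient.inductionOn with | _ κ =>
    refine Quotient.sound ?_
    have e : (κ.1.rename evenL).comp ((⟨0, [.var]⟩ : Cx).rename oddL) = κ.1.rename evenL := by
      rw [κ.2.eq_cons]
      simp [Cx.comp, Cx.rename, Cx.out, Cx.subst, Cx.append_def, Tm.rename, Tm.subst, Cx.cons]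
    change Eqn E ((κ.1.rename evenL).comp ((⟨0, [.var]⟩ : Cx).rename oddL)) κ.1 [F]
    rw [e]
    exact (Eqn.alpha _ evenL_injective κ.2).symm
  assoc {E F G H} f g h := by
    induction f using Quotient.inductionOn with | _ κ =>
    induction g using Quotient.inductionOn with | _ ζ =>
    induction h using Quotient.inductionOn with | _ ξ =>
    refine Quotient.sound ?_
    have t₁ := κ.2.rename evenL_injective
    have t₂ := ζ.2.rename oddL_injective
    have t := ((t₁.comp t₂ (apart_even_odd _ _)).rename evenL_injective).comp
      (ξ.2.rename oddL_injective) (apart_even_odd _ _)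
    have e : ((((κ.1.rename evenL).comp (ζ.1.rename oddL)).rename evenL).comp
          (ξ.1.rename oddL)).rename assocL =
        (κ.1.rename evenL).comp (((ζ.1.rename evenL).comp (ξ.1.rename oddL)).rename oddL) := by
      have h₁ : assocL ∘ evenL ∘ evenL = evenL := by
        funext n
        change assocL (2 * (2 * n)) = 2 * n
        rw [assocL, if_neg (by omega), if_pos (by omega)]; omega
      have h₂ : assocL ∘ evenL ∘ oddL = oddL ∘ evenL := by
        funext n
        change assocL (2 * (2 * n + 1)) = 2 * (2 * n) + 1
        rw [assocL, if_neg (by omega), if_neg (by omega)]; omega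
      have h₃ : assocL ∘ oddL = oddL ∘ oddL := by
        funext n
        change assocL (2 * n + 1) = 2 * (2 * n + 1) + 1
        rw [assocL, if_pos (by omega)]
      rw [Cx.rename_comp _ ((t₁.comp t₂ (apart_even_odd _ _)).rename evenL_injective),
        Cx.rename_comp _ t₁,
        Cx.rename_comp _ (t₁.rename evenL_injective), Cx.rename_comp _ (ζ.2.rename evenL_injective)]
      simp only [Cx.rename_rename]
      rw [h₁, h₂, h₃]
      exact Cx.comp_assoc _ t₁
        (ζ.2.rename (f := oddL ∘ evenL) (oddL_injective.comp evenL_injective))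
    have := Eqn.alpha assocL assocL_injective t
    rw [e] at this
    exact this

/-- The morphism `f : E ⟶ F` of the syntactic category is the class of the typed term
`x : E ▷ κ : F`. -/
def RepBy {E F : Formula} (f : E ⟶ F) (κ : Cx) : Prop :=
  ∃ h : Typed E κ [F], f = (Quotient.mk (termSetoid E F) ⟨κ, h⟩ : Mor E F)

/-! ### Left-closed categories and the interpretation of derivations -/

/-- A monoidal category is left closed when every functor `A ⊗ -` has a left adjoint
`- ∖ A`; here `(coexp A).obj C` is `C ∖ A`. -/
class LeftClosed (C : Type*) [Category C] [MonoidalCategory C] where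
  coexp : C → C ⥤ C
  adj : ∀ A : C, coexp A ⊣ tensorLeft A

section Interpretation

variable {C : Type*} [Category C] [MonoidalCategory C] [LeftClosed C]

/-- Interpretation of formulas, for an assignment of objects to the elementary formulas. -/
def Formula.interp (v : ℕ → C) : Formula → C
  | .atom n => v n
  | .bot => 𝟙_ C
  | .par A B => A.interp v ⊗ B.interp v
  | .sub A B => (LeftClosed.coexp (B.interp v)).obj (A.interp v)

/-- Interpretation of succedents. -/
def interpList (v : ℕ → C) : List Formula → C
  | [] => 𝟙_ C
  | A :: Γ => A.interp v ⊗ interpList v Γ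

/-- The canonical map from `⟦Γ⟧ ⊗ ⟦Δ⟧` to `⟦Γ, Δ⟧`. -/
def join (v : ℕ → C) : (Γ Δ : List Formula) →
    (interpList v Γ ⊗ interpList v Δ ⟶ interpList v (Γ ++ Δ))
  | [], Δ => (λ_ (interpList v Δ)).hom
  | A :: Γ, Δ => (α_ (A.interp v) (interpList v Γ) (interpList v Δ)).hom ≫
      (A.interp v) ◁ join v Γ Δ

variable [SymmetricCategory C]

/-- The symmetry that exchanges two adjacent formulas of a succedent. -/
def swapAt (v : ℕ → C) (A B : Formula) (Δ : List Formula) : (Γ : List Formula) →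
    (interpList v (Γ ++ A :: B :: Δ) ⟶ interpList v (Γ ++ B :: A :: Δ))
  | [] => (α_ (A.interp v) (B.interp v) (interpList v Δ)).inv ≫
      (β_ (A.interp v) (B.interp v)).hom ▷ interpList v Δ ≫
      (α_ (B.interp v) (A.interp v) (interpList v Δ)).hom
  | D :: Γ => D.interp v ◁ swapAt v A B Δ Γ

/-- Interpretation of derivations of typed terms in context. -/
def Der.interp (v : ℕ → C) : {E : Formula} → {κ : Cx} → {Γ : List Formula} → Der E κ Γ →
    (E.interp v ⟶ interpList v Γ)
  | _, _, _, .ax A => (ρ_ (A.interp v)).inv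
  | _, _, _, .exch (Γ := Γ) (Δ := Δ) (A := A) (B := B) _ d => d.interp v ≫ swapAt v A B Δ Γ
  | _, _, _, .cut (Γ := Γ) (Δ := Δ) d e _ =>
      d.interp v ≫ e.interp v ▷ interpList v Γ ≫ join v Δ Γ
  | _, _, _, .botI (Γ := Γ) d _ => d.interp v ≫ (λ_ (interpList v Γ)).inv
  | _, _, _, .botE => 𝟙 (𝟙_ C)
  | _, _, _, .subI (C := F) (D := D) (Γ := Γ) (Δ := Δ) _ d e _ _ _ =>
      d.interp v ≫
        ((LeftClosed.adj (D.interp v)).unit.app (F.interp v) ≫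
          e.interp v ▷ (LeftClosed.coexp (D.interp v)).obj (F.interp v) ≫
          (β_ (interpList v Δ) ((LeftClosed.coexp (D.interp v)).obj (F.interp v))).hom) ▷
            interpList v Γ ≫
        (α_ ((LeftClosed.coexp (D.interp v)).obj (F.interp v))
          (interpList v Δ) (interpList v Γ)).hom ≫
        (LeftClosed.coexp (D.interp v)).obj (F.interp v) ◁ join v Δ Γ
  | _, _, _, .subE (C := F) (D := D) (Γ := Γ) (Δ := Δ) _ d e _ _ _ =>
      d.interp v ≫
        ((LeftClosed.adj (D.interp v)).homEquiv (F.interp v) (interpList v Δ)).symm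
          (e.interp v) ▷ interpList v Γ ≫
        join v Δ Γ
  | _, _, _, .parI (A := A) (B := B) (Γ := Γ) d =>
      d.interp v ≫ (α_ (A.interp v) (B.interp v) (interpList v Γ)).inv
  | _, _, _, .parE (Γ := Γ) (Δ := Δ) (Λ := Λ) d e e' _ _ _ =>
      d.interp v ≫ (e.interp v ⊗ₘ e'.interp v) ▷ interpList v Γ ≫
        (α_ (interpList v Δ) (interpList v Λ) (interpList v Γ)).hom ≫
        interpList v Δ ◁ join v Λ Γ ≫ join v Δ (Λ ++ Γ)

end Interpretation

end CoILL

open CoILL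

open CategoryTheory MonoidalCategory

namespace CoILL

/-! ### Labels -/

/-! Equations between morphisms are tested by decomposing the target. Typed terms with input `E` and
any succedent, modulo derivable equations, form `Multi E`. A morphism `E ⟶ F` sends `Multi F` to
`Multi E` by cut (`act`), functorially, and elimination of par juxtaposes `χ` and `μ` into `box χ
μ`. Boxes of `one A` (a bare variable) and `unit` (the term `postp(x)`) are generic decompositions
of iterated pars. The η-equations for par and ⊥ say that a term can be rebuilt from its pieces, so
such boxes separate morphisms: `act f χ = act g χ` forces `f = g` (`Separates.box`,
`Multi.Sep.ext`).

The β-equations compute the action of the structural morphisms: the tensor product acts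
componentwise, the associator rebrackets boxes, the unitors insert `unit`. Most monoidal axioms
thereby become identities between nested boxes. The symmetry interchanges projections without being
visible as a box, so its laws are checked on explicit lists of terms, with exchange.

For left closure, a morphism into `A ⅋ B` is transposed by eliminating a variable of type `C ∖ A`.
Transposing and then composing with the unit is the identity by β for subtraction (`curry_uncurry`);
the other order is η (`uncurry_curry`).

Completeness is a term-model argument. In the syntactic category, with atoms interpreted by
themselves, the interpretation of a derivation, acting on the decomposition `elim Γ` of its target,
returns the class of the derived term (`interp_rep`). Equal interpretations therefore yield a
derivable equation. The interpretation of ⊥-introduction forgets the term to which ⊥ was connected;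
the rewiring equation makes up for this.

Side conditions on labels are met throughout by choosing representatives, via α, whose labels avoid
a given finite set. -/

theorem Tm.labels_subst {s : Srt} (R : Tm s) (T : Tm .m) :
    (R.subst T).labels = R.labels ∪ T.labels := by
  induction R with
  | var => simp [Tm.subst, Tm.labels]
  | app y M ih => simp [Tm.subst, Tm.labels, ih, Set.insert_union]
  | conn R ih => simp [Tm.subst, Tm.labels, ih]
  | par M N ih ih' =>
    simp only [Tm.subst, Tm.labels, ih, ih']
    ext; simp; tauto
  | casel M ih => simp [Tm.subst, Tm.labels, ih]
  | caser M ih => simp [Tm.subst, Tm.labels, ih]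
  | mkc M y ih => simp [Tm.subst, Tm.labels, ih, Set.insert_union]
  | postpone y N M _ ih => simp [Tm.subst, Tm.labels, ih, Set.insert_union, Set.union_assoc]
  | postp M ih => simp [Tm.subst, Tm.labels, ih]

theorem Tm.finite_labels {s : Srt} (R : Tm s) : R.labels.Finite := by
  induction R <;> simp_all [Tm.labels]

namespace Cx

theorem finite_labels (κ : Cx) : κ.labels.Finite := by
  have e : κ.labels =
      (⋃ P ∈ {P | P ∈ κ.ctrl}, Tm.labels P) ∪ ⋃ M ∈ {M | M ∈ κ.tms}, Tm.labels M := by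
    ext n; simp [labels]
  rw [e]
  refine Set.Finite.union (Set.Finite.biUnion ?_ fun P _ => P.finite_labels)
    (Set.Finite.biUnion ?_ fun M _ => M.finite_labels)
  · classical
    exact κ.ctrl.toFinset.finite_toSet.subset fun P hP => by simpa using hP
  · exact List.finite_toSet κ.tms

theorem mem_labels_mk {n : ℕ} {P : Multiset (Tm .p)} {Ms : List (Tm .m)} :
    n ∈ labels ⟨P, Ms⟩ ↔ (∃ R ∈ P, n ∈ R.labels) ∨ ∃ M ∈ Ms, n ∈ M.labels := Iff.rfl

theorem mem_labels_append {n : ℕ} {κ ζ : Cx} :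
    n ∈ (κ ++ ζ).labels ↔ n ∈ κ.labels ∨ n ∈ ζ.labels := by
  simp only [append_def, labels, Multiset.mem_add, List.mem_append,
    Set.mem_ofPred_eq]
  grind

theorem mem_labels_cons {n : ℕ} {κ : Cx} {M : Tm .m} :
    n ∈ (κ.cons M).labels ↔ n ∈ M.labels ∨ n ∈ κ.labels := by
  simp only [cons, labels, List.mem_cons, Set.mem_ofPred_eq]
  grind

theorem mem_labels_addCtrl {n : ℕ} {κ : Cx} {P : Tm .p} :
    n ∈ (κ.addCtrl P).labels ↔ n ∈ P.labels ∨ n ∈ κ.labels := by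
  simp only [addCtrl, labels, Multiset.mem_cons, Set.mem_ofPred_eq]
  grind

/-- Substitution into an empty context discards `T`, hence the nonemptiness clause. -/
theorem mem_labels_subst {n : ℕ} {κ : Cx} {T : Tm .m} :
    n ∈ (κ.subst T).labels ↔
      n ∈ κ.labels ∨ ((κ.ctrl ≠ 0 ∨ κ.tms ≠ []) ∧ n ∈ T.labels) := by
  simp only [subst, labels, Multiset.mem_map, List.mem_map, Set.mem_ofPred_eq,
    exists_exists_and_eq_and, Tm.labels_subst, Set.mem_union]
  have h₁ : κ.ctrl ≠ 0 ↔ ∃ R, R ∈ κ.ctrl :=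
    ⟨Multiset.exists_mem_of_ne_zero, fun ⟨R, hR⟩ h => by simp [h] at hR⟩
  have h₂ : κ.tms ≠ [] ↔ ∃ R, R ∈ κ.tms :=
    ⟨List.exists_mem_of_ne_nil _, fun ⟨R, hR⟩ h => by simp [h] at hR⟩
  rw [h₁, h₂]
  grind

theorem append_subst (κ ζ : Cx) (T : Tm .m) : (κ ++ ζ).subst T = κ.subst T ++ ζ.subst T := by
  simp [append_def, subst]

theorem append_assoc (κ ζ ξ : Cx) : κ ++ ζ ++ ξ = κ ++ (ζ ++ ξ) := by
  simp [append_def, add_assoc]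

end Cx

theorem apart_iff {κ ζ : Cx} : Apart κ ζ ↔ ∀ n, n ∈ κ.labels → n ∉ ζ.labels :=
  Set.disjoint_left

theorem Apart.symm {κ ζ : Cx} (h : Apart κ ζ) : Apart ζ κ := Disjoint.symm h

/-- An injective renaming that moves the labels of a context away from a finite set. -/
theorem exists_rename_disjoint (κ : Cx) {S : Set ℕ} (hS : S.Finite) :
    ∃ f : ℕ → ℕ, Function.Injective f ∧ Disjoint (κ.rename f).labels S := by
  obtain ⟨b, hb⟩ := hS.bddAbove
  -- A shift by one more than an upper bound of `S` lands beyond `S`.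
  refine ⟨fun n => n + (b + 1), fun m n h => by simpa using h, ?_⟩
  rw [Cx.labels_rename, Set.disjoint_left]
  rintro _ ⟨n, _, rfl⟩ hn
  have := hb hn
  simp only at this
  omega

/-! ### Exchange -/

/-- A permutation is a composite of adjacent transpositions, each an exchange. Pairing terms with
formulas keeps the two lists aligned. -/
theorem Typed.perm {E : Formula} {P : Multiset (Tm .p)} {l l' : List (Tm .m × Formula)}
    (h : l.Perm l') (t : Typed E ⟨P, l.map Prod.fst⟩ (l.map Prod.snd)) :
    Typed E ⟨P, l'.map Prod.fst⟩ (l'.map Prod.snd) := by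
  -- A prefix is generalised because exchange acts at any depth: in the `cons` case the head joins
  -- the prefix.
  suffices H : ∀ p : List (Tm .m × Formula),
      Typed E ⟨P, (p ++ l).map Prod.fst⟩ ((p ++ l).map Prod.snd) →
      Typed E ⟨P, (p ++ l').map Prod.fst⟩ ((p ++ l').map Prod.snd) from H [] t
  clear t
  induction h with
  | nil => exact fun _ t => t
  | cons a _ ih =>
    intro p t
    have := ih (p ++ [a])
    simp only [List.append_assoc, List.singleton_append] at this
    exact this t
  | swap a b l =>
    rintro p ⟨t⟩
    simp only [List.map_append, List.map_cons] at t ⊢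
    exact ⟨Der.exch (by simp) t⟩
  | trans _ _ ih ih' => exact fun p t => ih' p (ih p t)

theorem Eqn.perm {E : Formula} {P P' : Multiset (Tm .p)} {l l' : List (Tm .m × Tm .m × Formula)}
    (h : l.Perm l')
    (t : Eqn E ⟨P, l.map fun a => a.1⟩ ⟨P', l.map fun a => a.2.1⟩ (l.map fun a => a.2.2)) :
    Eqn E ⟨P, l'.map fun a => a.1⟩ ⟨P', l'.map fun a => a.2.1⟩ (l'.map fun a => a.2.2) := by
  suffices H : ∀ p : List (Tm .m × Tm .m × Formula),
      Eqn E ⟨P, (p ++ l).map fun a => a.1⟩ ⟨P', (p ++ l).map fun a => a.2.1⟩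
        ((p ++ l).map fun a => a.2.2) →
      Eqn E ⟨P, (p ++ l').map fun a => a.1⟩ ⟨P', (p ++ l').map fun a => a.2.1⟩
        ((p ++ l').map fun a => a.2.2) from H [] t
  clear t
  induction h with
  | nil => exact fun _ t => t
  | cons a _ ih =>
    intro p t
    have := ih (p ++ [a])
    simp only [List.append_assoc, List.singleton_append] at this
    exact this t
  | swap a b l =>
    intro p t
    simp only [List.map_append, List.map_cons] at t ⊢
    exact Eqn.exch (by simp) (by simp) t
  | trans _ _ ih ih' => exact fun p t => ih' p (ih p t)

theorem Typed.swap_blocks {E : Formula} {κ₁ κ₂ κ₃ : Cx} {Γ₁ Γ₂ Γ₃ : List Formula}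
    (h₁ : κ₁.tms.length = Γ₁.length) (h₂ : κ₂.tms.length = Γ₂.length)
    (t : Typed E (κ₁ ++ (κ₂ ++ κ₃)) (Γ₁ ++ (Γ₂ ++ Γ₃))) :
    Typed E (κ₂ ++ (κ₁ ++ κ₃)) (Γ₂ ++ (Γ₁ ++ Γ₃)) := by
  have h₃ : κ₃.tms.length = Γ₃.length := by
    have := t.length
    simp only [Cx.append_def, List.length_append] at this
    omega
  have p : ((κ₁.tms.zip Γ₁) ++ ((κ₂.tms.zip Γ₂) ++ κ₃.tms.zip Γ₃)).Perm
      ((κ₂.tms.zip Γ₂) ++ ((κ₁.tms.zip Γ₁) ++ κ₃.tms.zip Γ₃)) := by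
    rw [← List.append_assoc, ← List.append_assoc]
    exact List.perm_append_comm.append_right _
  have := Typed.perm (E := E) (P := κ₁.ctrl + (κ₂.ctrl + κ₃.ctrl)) p
  simp only [List.map_append, List.map_fst_zip h₁.le, List.map_fst_zip h₂.le,
    List.map_fst_zip h₃.le, List.map_snd_zip h₁.ge, List.map_snd_zip h₂.ge,
    List.map_snd_zip h₃.ge] at this
  have := this t
  rwa [add_left_comm] at this

theorem Eqn.swap_blocks {E : Formula} {κ₁ κ₂ κ₃ κ₁' κ₂' κ₃' : Cx} {Γ₁ Γ₂ Γ₃ : List Formula}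
    (h₁ : κ₁.tms.length = Γ₁.length) (h₂ : κ₂.tms.length = Γ₂.length)
    (h₃ : κ₃.tms.length = Γ₃.length)
    (h₁' : κ₁'.tms.length = Γ₁.length) (h₂' : κ₂'.tms.length = Γ₂.length)
    (h₃' : κ₃'.tms.length = Γ₃.length)
    (t : Eqn E (κ₁ ++ (κ₂ ++ κ₃)) (κ₁' ++ (κ₂' ++ κ₃')) (Γ₁ ++ (Γ₂ ++ Γ₃))) :
    Eqn E (κ₂ ++ (κ₁ ++ κ₃)) (κ₂' ++ (κ₁' ++ κ₃')) (Γ₂ ++ (Γ₁ ++ Γ₃)) := by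
  have p : ((κ₁.tms.zip (κ₁'.tms.zip Γ₁)) ++
        ((κ₂.tms.zip (κ₂'.tms.zip Γ₂)) ++ κ₃.tms.zip (κ₃'.tms.zip Γ₃))).Perm
      ((κ₂.tms.zip (κ₂'.tms.zip Γ₂)) ++
        ((κ₁.tms.zip (κ₁'.tms.zip Γ₁)) ++ κ₃.tms.zip (κ₃'.tms.zip Γ₃))) := by
    rw [← List.append_assoc, ← List.append_assoc]
    exact List.perm_append_comm.append_right _
  have z : ∀ {Ms Ms' : List (Tm .m)} {Γ : List Formula}, Ms.length = Γ.length →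
      Ms'.length = Γ.length →
      ((Ms.zip (Ms'.zip Γ)).map fun a => a.1) = Ms ∧
      ((Ms.zip (Ms'.zip Γ)).map fun a => a.2.1) = Ms' ∧
      ((Ms.zip (Ms'.zip Γ)).map fun a => a.2.2) = Γ := by
    intro Ms Ms' Γ h h'
    have e₁ : (fun a : Tm .m × Tm .m × Formula => a.2.1) = Prod.fst ∘ Prod.snd := rfl
    have e₂ : (fun a : Tm .m × Tm .m × Formula => a.2.2) = Prod.snd ∘ Prod.snd := rfl
    refine ⟨List.map_fst_zip (by simp [h, h']), ?_, ?_⟩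
    · rw [e₁, ← List.map_map, List.map_snd_zip (by simp [h, h']), List.map_fst_zip h'.le]
    · rw [e₂, ← List.map_map, List.map_snd_zip (by simp [h, h']), List.map_snd_zip h'.ge]
  have := Eqn.perm (E := E) (P := κ₁.ctrl + (κ₂.ctrl + κ₃.ctrl))
    (P' := κ₁'.ctrl + (κ₂'.ctrl + κ₃'.ctrl)) p
  simp only [List.map_append, z h₁ h₁', z h₂ h₂', z h₃ h₃'] at this
  have := this t
  rwa [add_left_comm, add_left_comm κ₁'.ctrl] at this

/-! ### Both sides of an equation in context are typed -/

section

variable {E A B C D : Formula} {κ ζ ξ : Cx} {M N : Tm .m} {Γ Δ Λ : List Formula}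

theorem Typed.var (A : Formula) : Typed A ⟨0, [.var]⟩ [A] := ⟨Der.ax A⟩

theorem Typed.postp_var : Typed .bot ⟨{.postp .var}, []⟩ [] := ⟨Der.botE⟩

theorem Typed.cut (d : Typed E (κ.cons M) (A :: Γ)) (e : Typed A ζ Δ)
    (h : Apart (κ.cons M) ζ) : Typed E (ζ.subst M ++ κ) (Δ ++ Γ) :=
  d.elim fun d => e.elim fun e => ⟨Der.cut d e h⟩

theorem Typed.botI {s : Srt} {R : Tm s} (d : Typed E κ Γ) (hR : κ.Mem R) :
    Typed E (κ.cons (.conn R)) (.bot :: Γ) :=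
  d.elim fun d => ⟨Der.botI d hR⟩

theorem Typed.subI (y : ℕ) (d : Typed E (κ.cons M) (C :: Γ)) (e : Typed D ζ Δ)
    (h : Apart (κ.cons M) ζ) (hy : Fresh y (κ.cons M)) (hy' : Fresh y ζ) :
    Typed E ((ζ.subst (.app y M) ++ κ).cons (.mkc M y)) (.sub C D :: (Δ ++ Γ)) :=
  d.elim fun d => e.elim fun e => ⟨Der.subI y d e h hy hy'⟩

theorem Typed.subE (x : ℕ) (d : Typed E (κ.cons M) (.sub C D :: Γ))
    (e : Typed C (ζ.cons N) (D :: Δ)) (h : Apart (κ.cons M) (ζ.cons N))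
    (hx : Fresh x (κ.cons M)) (hx' : Fresh x (ζ.cons N)) :
    Typed E ((ζ.subst (.app x M) ++ κ).addCtrl (.postpone x N M)) (Δ ++ Γ) :=
  d.elim fun d => e.elim fun e => ⟨Der.subE x d e h hx hx'⟩

theorem Typed.parI (d : Typed E ((κ.cons N).cons M) (A :: B :: Γ)) :
    Typed E (κ.cons (.par M N)) (.par A B :: Γ) :=
  d.elim fun d => ⟨Der.parI d⟩

theorem Typed.parE (d : Typed E (κ.cons M) (.par A B :: Γ)) (e : Typed A ζ Δ) (e' : Typed B ξ Λ)
    (h₁ : Apart (κ.cons M) ζ) (h₂ : Apart (κ.cons M) ξ) (h₃ : Apart ζ ξ) :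
    Typed E (ζ.subst (.casel M) ++ (ξ.subst (.caser M) ++ κ)) (Δ ++ (Λ ++ Γ)) :=
  d.elim fun d => e.elim fun e => e'.elim fun e' => ⟨Der.parE d e e' h₁ h₂ h₃⟩

theorem Typed.swap_two {P : Multiset (Tm .p)} {Ms : List (Tm .m)}
    (d : Typed E ⟨P, M :: N :: Ms⟩ (A :: B :: Γ)) : Typed E ⟨P, N :: M :: Ms⟩ (B :: A :: Γ) :=
  d.elim fun d => ⟨Der.exch (Ms := []) (Γ := []) rfl d⟩

/-- Two successive cuts; in between, the block `Λ` is moved behind `A` so that `M` is again at the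
head. This types the contractum of β for par. -/
theorem Typed.cut₂ (d : Typed E ((κ.cons N).cons M) (A :: B :: Γ)) (e : Typed A ζ Δ)
    (e' : Typed B ξ Λ) (h₁ : Apart ((κ.cons N).cons M) ζ) (h₂ : Apart ((κ.cons N).cons M) ξ)
    (h₃ : Apart ζ ξ) :
    Typed E (ζ.subst M ++ (ξ.subst N ++ κ)) (Δ ++ (Λ ++ Γ)) := by
  have t := (d.swap_two.cut (κ := κ.cons M) e' (by
    simp only [apart_iff, Cx.mem_labels_cons] at *; grind))
  have l₁ : (ζ.subst M).tms.length = Δ.length := by simpa [Cx.subst] using e.length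
  have l₂ : (ξ.subst N).tms.length = Λ.length := by simpa [Cx.subst] using e'.length
  have t' : Typed E (⟨0, [M]⟩ ++ (ξ.subst N ++ κ)) ([A] ++ (Λ ++ Γ)) := by
    refine Typed.swap_blocks l₂ rfl ?_
    simpa [Cx.append_def, Cx.cons] using t
  have t'' : Typed E ((ξ.subst N ++ κ).cons M) (A :: (Λ ++ Γ)) := by
    simpa [Cx.append_def, Cx.cons] using t'
  refine t''.cut e ?_
  simp only [apart_iff, Cx.mem_labels_cons, Cx.mem_labels_append, Cx.mem_labels_subst] at *
  grind

end

/-- The compatibility rules mirror the typing rules, so the work lies in the β and η axioms. Passing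
to an equal representative in the quotients depends on this. -/
theorem Eqn.typed {E : Formula} {κ κ' : Cx} {Γ : List Formula} (h : Eqn E κ κ' Γ) :
    Typed E κ Γ ∧ Typed E κ' Γ := by
  induction h with
  | refl h => exact ⟨h, h⟩
  | symm _ ih => exact ih.symm
  | trans _ _ ih ih' => exact ⟨ih.1, ih'.2⟩
  | subst _ _ a a' ih ih' => exact ⟨ih.1.cut ih'.1 a, ih.2.cut ih'.2 a'⟩
  | exch hlen hlen' _ ih =>
    obtain ⟨⟨d⟩, ⟨d'⟩⟩ := ih
    exact ⟨⟨Der.exch hlen d⟩, ⟨Der.exch hlen' d'⟩⟩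
  | botI _ hR hR' ih => exact ⟨ih.1.botI hR, ih.2.botI hR'⟩
  | subI y _ _ a a' h₁ h₂ h₃ h₄ ih ih' =>
    exact ⟨ih.1.subI y ih'.1 a h₁ h₂, ih.2.subI y ih'.2 a' h₃ h₄⟩
  | subE x _ _ a a' h₁ h₂ h₃ h₄ ih ih' =>
    exact ⟨ih.1.subE x ih'.1 a h₁ h₂, ih.2.subE x ih'.2 a' h₃ h₄⟩
  | parI _ ih => exact ⟨ih.1.parI, ih.2.parI⟩
  | parE _ _ _ a₁ a₂ a₃ a₁' a₂' a₃' ih ih' ih'' =>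
    exact ⟨ih.1.parE ih'.1 ih''.1 a₁ a₂ a₃, ih.2.parE ih'.2 ih''.2 a₁' a₂' a₃'⟩
  | alpha f hf h => exact ⟨h, h.rename hf⟩
  | parBeta h k l a₁ a₂ a₃ =>
    refine ⟨h.parI.parE k l ?_ ?_ a₃, h.cut₂ k l a₁ a₂ a₃⟩ <;>
    · simp only [apart_iff, Cx.mem_labels_cons, Tm.labels, Set.mem_union] at *
      grind
  | parEta h =>
    refine ⟨?_, h⟩
    refine Typed.parI ?_
    have := h.parE (Typed.var _) (Typed.var _)
      (by simp [apart_iff, Cx.mem_labels_mk, Tm.labels])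
      (by simp [apart_iff, Cx.mem_labels_mk, Tm.labels])
      (by simp [apart_iff, Cx.mem_labels_mk, Tm.labels])
    simpa [Cx.subst, Cx.append_def, Cx.cons, Tm.subst] using this
  | @subBeta E A B κ ζ ξ M L Γ Δ Λ y z h k l a₁ a₂ a₃ hyz hy₁ hy₂ hy₃ hz₁ hz₂ hz₃ =>
    constructor
    · refine Typed.subE z (h.subI y k a₁ hy₁ hy₂) l ?_ ?_ hz₃
      · simp only [apart_iff, Fresh, Cx.mem_labels_cons, Cx.mem_labels_append,
          Cx.mem_labels_subst, Tm.labels, Set.mem_insert_iff] at *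
        grind
      · simp only [apart_iff, Fresh, Cx.mem_labels_cons, Cx.mem_labels_append,
          Cx.mem_labels_subst, Tm.labels, Set.mem_insert_iff] at *
        grind
    -- The contractum is typed by cutting `ξ, L` at `M` and then `ζ` at `L[M]`; the two blocks come
    -- out in the opposite order.
    · have t := h.cut l a₂
      have t' : Typed E ((ξ.subst M ++ κ).cons (L.subst M)) (B :: (Λ ++ Γ)) := t
      have t'' := t'.cut k (by
        simp only [apart_iff, Fresh, Cx.mem_labels_cons, Cx.mem_labels_append,
          Cx.mem_labels_subst, Tm.labels_subst, Set.mem_union] at *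
        grind)
      refine Typed.swap_blocks ?_ ?_ t''
      · simpa [Cx.subst] using k.length
      · simpa [Cx.subst, Cx.cons] using l.length
  | @subEta E A B κ M Γ x y h hxy hx hy =>
    refine ⟨?_, h⟩
    -- Introduction on axioms yields `y(x)` and `mkc(x, y)`; the former is the term postponed by the
    -- elimination of `M`.
    have e : Typed A ⟨0, [.app y .var, .mkc .var y]⟩ [B, .sub A B] :=
      ((Typed.var A).subI (κ := ⟨0, []⟩) y (Typed.var B)
        (by simp [apart_iff, Cx.mem_labels_mk, Tm.labels, Cx.cons])
        (by simp [Fresh, Cx.mem_labels_mk, Tm.labels, Cx.cons])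
        (by simp [Fresh, Cx.mem_labels_mk, Tm.labels])).swap_two
    have := h.subE x (ζ := ⟨0, [.mkc .var y]⟩) (N := .app y .var) e
      (by
        simp only [Fresh, apart_iff, Cx.mem_labels_cons] at hy ⊢
        simp [Cx.mem_labels_mk, Tm.labels]
        grind)
      hx (by simp [Fresh, Cx.cons, Cx.mem_labels_mk, Tm.labels, hxy])
    simpa [Cx.subst, Cx.append_def, Cx.cons, Tm.subst, Cx.addCtrl] using this
  | rewire h k k' => exact ⟨k, k'⟩
  | @botBeta E κ Γ s R h hR =>
    refine ⟨?_, h⟩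
    have := (h.botI hR).cut Typed.postp_var (by
      simp [apart_iff, Cx.mem_labels_mk, Tm.labels])
    simpa [Cx.subst, Cx.append_def, Cx.addCtrl, Tm.subst] using this
  | @botEta E κ M Γ h =>
    refine ⟨?_, h⟩
    have := (h.cut Typed.postp_var (by
      simp [apart_iff, Cx.mem_labels_mk, Tm.labels])).botI (R := Tm.postp M)
      (by simp [Cx.Mem, Cx.append_def, Cx.subst, Tm.subst])
    simpa [Cx.subst, Cx.append_def, Cx.addCtrl, Tm.subst, Cx.cons] using this

theorem Eqn.swap_two {E A B : Formula} {P P' : Multiset (Tm .p)} {M N M' N' : Tm .m}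
    {Ms Ms' : List (Tm .m)} {Γ : List Formula}
    (d : Eqn E ⟨P, M :: N :: Ms⟩ ⟨P', M' :: N' :: Ms'⟩ (A :: B :: Γ)) :
    Eqn E ⟨P, N :: M :: Ms⟩ ⟨P', N' :: M' :: Ms'⟩ (B :: A :: Γ) :=
  Eqn.exch (Ms := []) (Ms' := []) (Γ := []) rfl rfl d

/-! ### Representatives of morphisms -/

namespace RepBy

variable {E F G : Formula} {f g : E ⟶ F} {κ κ' : Cx}

theorem typed (h : RepBy f κ) : Typed E κ [F] := h.1

theorem congr (h : RepBy f κ) (e : Eqn E κ κ' [F]) : RepBy f κ' := by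
  obtain ⟨t, rfl⟩ := h
  exact ⟨e.typed.2, Quotient.sound e⟩

theorem eq (h : RepBy f κ) (h' : RepBy g κ) : f = g := by
  obtain ⟨t, rfl⟩ := h
  obtain ⟨t', rfl⟩ := h'
  rfl

theorem id (E : Formula) : RepBy (𝟙 E) ⟨0, [.var]⟩ := ⟨Typed.var E, rfl⟩

/-- The even and odd relabellings in the definition of composition are undone by α, so any
representatives with disjoint labels may be cut directly. -/
theorem comp {g : F ⟶ G} {ζ : Cx} (h : RepBy f κ) (k : RepBy g ζ) (a : Apart κ ζ) :
    RepBy (f ≫ g) (κ.comp ζ) := by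
  obtain ⟨t, rfl⟩ := h
  obtain ⟨t', rfl⟩ := k
  refine ⟨t.comp t' a, Quotient.sound ?_⟩
  exact Eqn.comp (Eqn.alpha _ evenL_injective t).symm (Eqn.alpha _ oddL_injective t').symm
    (t.rename evenL_injective) t (apart_even_odd _ _) a

theorem rename {r : ℕ → ℕ} (hr : Function.Injective r) (h : RepBy f κ) :
    RepBy f (κ.rename r) :=
  h.congr (Eqn.alpha r hr h.typed)

end RepBy

theorem exists_repBy {E F : Formula} (f : E ⟶ F) {S : Set ℕ} (hS : S.Finite) :
    ∃ P M, RepBy f ⟨P, [M]⟩ ∧ Disjoint (Cx.labels ⟨P, [M]⟩) S := by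
  induction f using Quotient.inductionOn with | _ κ =>
  obtain ⟨r, hr, hd⟩ := exists_rename_disjoint κ.1 hS
  have h : RepBy (Quotient.mk (termSetoid E F) κ : Mor E F) κ.1 := ⟨κ.2, rfl⟩
  have h' := h.rename hr
  have e := h'.typed.eq_cons
  refine ⟨(κ.1.rename r).ctrl, (κ.1.rename r).out, ?_, ?_⟩
  · rw [e] at h'; exact h'
  · rw [e] at hd; exact hd

theorem Cx.comp_mk (P : Multiset (Tm .p)) (M : Tm .m) (ζ : Cx) :
    Cx.comp ⟨P, [M]⟩ ζ = ζ.subst M ++ (⟨P, []⟩ : Cx) := rfl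

/-! ### Typed terms in context with several conclusions, modulo equations -/

/-- A typed term in context with an arbitrary succedent. -/
structure PreMulti (E : Formula) : Type where
  cx : Cx
  out : List Formula
  typed : Typed E cx out

/-- The succedent is data rather than an index, so that terms whose succedents agree only up to
`List.append_assoc` can be compared without transport. -/
instance multiSetoid (E : Formula) : Setoid (PreMulti E) where
  r κ ζ := κ.out = ζ.out ∧ Eqn E κ.cx ζ.cx κ.out
  iseqv :=
    ⟨fun κ => ⟨rfl, Eqn.refl κ.typed⟩, fun h => ⟨h.1.symm, h.1 ▸ h.2.symm⟩,
      fun h k => ⟨h.1.trans k.1, h.2.trans (h.1 ▸ k.2)⟩⟩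

/-- Typed terms in context with input `E` and any succedent, modulo equations in context. -/
def Multi (E : Formula) : Type := Quotient (multiSetoid E)

namespace Multi

variable {E F G A B C : Formula} {κ κ' ζ ξ : Cx} {Γ Δ Λ : List Formula}

/-- `χ` is the class of `x : E ▷ κ : Γ`. -/
def Rep (χ : Multi E) (κ : Cx) (Γ : List Formula) : Prop :=
  ∃ h : Typed E κ Γ, χ = Quotient.mk (multiSetoid E) ⟨κ, Γ, h⟩

theorem Rep.typed {χ : Multi E} (h : Rep χ κ Γ) : Typed E κ Γ := h.1

theorem Rep.eqn {χ : Multi E} (h : Rep χ κ Γ) (h' : Rep χ κ' Γ) : Eqn E κ κ' Γ := by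
  obtain ⟨t, e⟩ := h
  obtain ⟨t', e'⟩ := h'
  exact (Quotient.exact (e.symm.trans e')).2

theorem Rep.out_eq {χ : Multi E} (h : Rep χ κ Γ) (h' : Rep χ κ' Δ) : Γ = Δ := by
  obtain ⟨t, e⟩ := h
  obtain ⟨t', e'⟩ := h'
  exact (Quotient.exact (e.symm.trans e')).1

theorem Rep.congr {χ : Multi E} (h : Rep χ κ Γ) (e : Eqn E κ κ' Γ) : Rep χ κ' Γ := by
  obtain ⟨t, rfl⟩ := h
  exact ⟨e.typed.2, Quotient.sound ⟨rfl, e⟩⟩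

theorem Rep.eq {χ μ : Multi E} (h : Rep χ κ Γ) (h' : Rep μ κ Γ) : χ = μ := by
  obtain ⟨t, rfl⟩ := h
  obtain ⟨t', rfl⟩ := h'
  rfl

theorem exists_rep (χ : Multi E) {S : Set ℕ} (hS : S.Finite) :
    ∃ κ Γ, Rep χ κ Γ ∧ Disjoint κ.labels S := by
  induction χ using Quotient.inductionOn with | _ κ =>
  obtain ⟨κ, Γ, t⟩ := κ
  obtain ⟨r, hr, hd⟩ := exists_rename_disjoint κ hS
  have h : Rep (Quotient.mk (multiSetoid E) ⟨κ, Γ, t⟩) κ Γ := ⟨t, rfl⟩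
  exact ⟨_, Γ, h.congr (Eqn.alpha r hr t), hd⟩

end Multi

/-! ### Cut and juxtaposition for terms with several conclusions -/

theorem Typed.compMulti {E F : Formula} {κ ζ : Cx} {Γ : List Formula} (h : Typed E κ [F])
    (k : Typed F ζ Γ) (a : Apart κ ζ) : Typed E (κ.comp ζ) Γ := by
  have e := h.eq_cons
  rw [e] at h a
  have := h.cut k a
  rwa [List.append_nil] at this

theorem Eqn.compMulti {E F : Formula} {κ κ' ζ ζ' : Cx} {Γ : List Formula} (h : Eqn E κ κ' [F])
    (k : Eqn F ζ ζ' Γ) (a : Apart κ ζ) (a' : Apart κ' ζ') :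
    Eqn E (κ.comp ζ) (κ'.comp ζ') Γ := by
  have e := h.typed.1.eq_cons
  have e' := h.typed.2.eq_cons
  rw [e] at a
  rw [e'] at a'
  rw [e, e'] at h
  have := Eqn.subst h k a a'
  rwa [List.append_nil] at this

theorem apart_of_labels_eq_empty {κ ζ : Cx} (h : κ.labels = ∅) : Apart κ ζ := by
  simp [Apart, h]

theorem Typed.box {A B : Formula} {ζ ξ : Cx} {Δ Λ : List Formula} (h : Typed A ζ Δ)
    (k : Typed B ξ Λ) (a : Apart ζ ξ) :
    Typed (.par A B) (ζ.subst (.casel .var) ++ ξ.subst (.caser .var)) (Δ ++ Λ) := by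
  have := (Typed.var (.par A B)).parE (κ := ⟨0, []⟩) h k
    (apart_of_labels_eq_empty (by ext; simp [Cx.cons, Cx.mem_labels_mk, Tm.labels]))
    (apart_of_labels_eq_empty (by ext; simp [Cx.cons, Cx.mem_labels_mk, Tm.labels])) a
  simpa [Cx.append_def] using this

theorem Eqn.box {A B : Formula} {ζ ξ ζ' ξ' : Cx} {Δ Λ : List Formula} (h : Eqn A ζ ζ' Δ)
    (k : Eqn B ξ ξ' Λ) (a : Apart ζ ξ) (a' : Apart ζ' ξ') :
    Eqn (.par A B) (ζ.subst (.casel .var) ++ ξ.subst (.caser .var))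
      (ζ'.subst (.casel .var) ++ ξ'.subst (.caser .var)) (Δ ++ Λ) := by
  have e : ((⟨0, []⟩ : Cx).cons .var).labels = ∅ := by
    ext; simp [Cx.cons, Cx.mem_labels_mk, Tm.labels]
  have := (Eqn.refl (Typed.var (.par A B))).parE (κ := ⟨0, []⟩) (κ' := ⟨0, []⟩) h k
    (apart_of_labels_eq_empty e) (apart_of_labels_eq_empty e) a
    (apart_of_labels_eq_empty e) (apart_of_labels_eq_empty e) a'
  simpa [Cx.append_def] using this

namespace Multi

variable {E F G A B C : Formula} {κ κ' ζ ξ : Cx} {Γ Δ Λ : List Formula}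

/-- Precomposition of a term in context with a morphism. -/
def act (f : E ⟶ F) (χ : Multi F) : Multi E :=
  Quotient.map₂ (sa := termSetoid E F) (sb := multiSetoid F) (sc := multiSetoid E)
    (fun (κ : TermIn E F) (ζ : PreMulti F) =>
      (⟨(κ.1.rename evenL).comp (ζ.cx.rename oddL), ζ.out,
        (κ.2.rename evenL_injective).compMulti (ζ.typed.rename oddL_injective)
          (apart_even_odd _ _)⟩ : PreMulti E))
    (fun κ κ' h ζ ζ' k => ⟨k.1, Eqn.compMulti (Eqn.rename evenL_injective h κ.2 κ'.2)
        (Eqn.rename oddL_injective k.2 ζ.typed (k.1 ▸ ζ'.typed))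
        (apart_even_odd _ _) (apart_even_odd _ _)⟩) f χ

/-- Juxtaposition of two terms in context whose inputs are the components of a par. -/
def box (χ : Multi A) (μ : Multi B) : Multi (.par A B) :=
  Quotient.map₂ (sa := multiSetoid A) (sb := multiSetoid B) (sc := multiSetoid (.par A B))
    (fun (ζ : PreMulti A) (ξ : PreMulti B) =>
      (⟨(ζ.cx.rename evenL).subst (.casel .var) ++ (ξ.cx.rename oddL).subst (.caser .var),
        ζ.out ++ ξ.out, (ζ.typed.rename evenL_injective).box (ξ.typed.rename oddL_injective)
          (apart_even_odd _ _)⟩ : PreMulti (.par A B)))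
    (fun κ κ' h ζ ζ' k => ⟨by
        change κ.out ++ ζ.out = κ'.out ++ ζ'.out
        rw [h.1, k.1], Eqn.box (Eqn.rename evenL_injective h.2 κ.typed (h.1 ▸ κ'.typed))
        (Eqn.rename oddL_injective k.2 ζ.typed (k.1 ▸ ζ'.typed))
        (apart_even_odd _ _) (apart_even_odd _ _)⟩) χ μ

/-- The identity term in context. -/
def one (A : Formula) : Multi A := Quotient.mk _ ⟨⟨0, [.var]⟩, [A], Typed.var A⟩

/-- The elimination of `⊥`. -/
def unit : Multi .bot := Quotient.mk _ ⟨⟨{.postp .var}, []⟩, [], Typed.postp_var⟩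

theorem one_rep (A : Formula) : Rep (one A) ⟨0, [.var]⟩ [A] := ⟨_, rfl⟩

theorem unit_rep : Rep unit ⟨{.postp .var}, []⟩ [] := ⟨_, rfl⟩

theorem act_rep {f : E ⟶ F} {χ : Multi F} (h : RepBy f κ) (k : Rep χ ζ Γ) (a : Apart κ ζ) :
    Rep (act f χ) (κ.comp ζ) Γ := by
  obtain ⟨t, rfl⟩ := h
  obtain ⟨t', rfl⟩ := k
  refine ⟨t.compMulti t' a, Quotient.sound ⟨rfl, ?_⟩⟩
  exact Eqn.compMulti (Eqn.alpha _ evenL_injective t).symm (Eqn.alpha _ oddL_injective t').symm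
    (apart_even_odd _ _) a

theorem box_rep {χ : Multi A} {μ : Multi B} (h : Rep χ ζ Δ) (k : Rep μ ξ Λ) (a : Apart ζ ξ) :
    Rep (box χ μ) (ζ.subst (.casel .var) ++ ξ.subst (.caser .var)) (Δ ++ Λ) := by
  obtain ⟨t, rfl⟩ := h
  obtain ⟨t', rfl⟩ := k
  refine ⟨t.box t' a, Quotient.sound ⟨rfl, ?_⟩⟩
  exact Eqn.box (Eqn.alpha _ evenL_injective t).symm (Eqn.alpha _ oddL_injective t').symm
    (apart_even_odd _ _) a

theorem act_id (χ : Multi E) : act (𝟙 E) χ = χ := by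
  obtain ⟨κ, Γ, h, -⟩ := exists_rep χ Set.finite_empty
  have := act_rep (RepBy.id E) h
    (apart_of_labels_eq_empty (by ext; simp [Cx.mem_labels_mk, Tm.labels]))
  refine Rep.eq this ?_
  simpa [Cx.comp_mk, Cx.subst_var, Cx.append_def] using h

theorem act_comp (f : E ⟶ F) (g : F ⟶ G) (χ : Multi G) :
    act (f ≫ g) χ = act f (act g χ) := by
  obtain ⟨ζ, Γ, h, -⟩ := exists_rep χ Set.finite_empty
  obtain ⟨Q, N, hg, dg⟩ := exists_repBy g ζ.finite_labels
  obtain ⟨P, M, hf, df⟩ := exists_repBy f (ζ.finite_labels.union (Cx.finite_labels ⟨Q, [N]⟩))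
  rw [Set.disjoint_union_right] at df
  have a : Apart (Cx.comp ⟨P, [M]⟩ ⟨Q, [N]⟩) ζ := by
    simp only [Set.disjoint_left] at df dg
    simp [apart_iff, Cx.comp, Cx.mem_labels_append, Cx.mem_labels_subst, Cx.out,
      Cx.mem_labels_mk] at *
    grind
  have b : Apart ⟨P, [M]⟩ (Cx.comp ⟨Q, [N]⟩ ζ) := by
    simp only [Set.disjoint_left] at df dg
    simp [apart_iff, Cx.comp, Cx.mem_labels_append, Cx.mem_labels_subst, Cx.out,
      Cx.mem_labels_mk] at *
    grind
  have l := act_rep (hf.comp hg df.2) h a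
  rw [Cx.comp_assoc ζ hf.typed hg.typed] at l
  exact l.eq (act_rep hf (act_rep hg h dg) b)

/-- The effect of a morphism `M ⅋ N` on a juxtaposition. -/
theorem act_box_rep {f : E ⟶ A.par B} {P : Multiset (Tm .p)} {M N : Tm .m} {χ : Multi A}
    {μ : Multi B} (hf : RepBy f ⟨P, [.par M N]⟩) (t : Typed E ⟨P, [M, N]⟩ [A, B])
    (h : Rep χ ζ Δ) (k : Rep μ ξ Λ) (a₁ : Apart ⟨P, [M, N]⟩ ζ) (a₂ : Apart ⟨P, [M, N]⟩ ξ)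
    (a₃ : Apart ζ ξ) :
    Rep (act f (box χ μ)) (ζ.subst M ++ (ξ.subst N ++ ⟨P, []⟩)) (Δ ++ Λ) := by
  have r := act_rep hf (box_rep h k a₃) (by
    simp [apart_iff, Cx.mem_labels_append, Cx.mem_labels_subst,
      Cx.mem_labels_mk, Tm.labels] at *
    grind)
  -- The action creates the redexes `casel(M ⅋ N)` and `caser(M ⅋ N)`.
  have e := Eqn.parBeta (κ := ⟨P, []⟩) (Γ := []) t h.typed k.typed a₁ a₂ a₃
  rw [List.append_nil] at e
  refine r.congr ?_
  rw [Cx.comp_mk, Cx.append_subst, Cx.append_assoc, Cx.subst_subst, Cx.subst_subst]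
  exact e

end Multi

/-- The conclusions of `χ` determine its input: `κ, M` is determined by `κ, χ[x := M]`. -/
structure Separates (F : Formula) (χ : Cx) (Γ : List Formula) : Prop where
  typed : Typed F χ Γ
  labels : χ.labels = ∅
  cons : ∀ {E : Formula} {κ κ' : Cx} {M M' : Tm .m} {Λ : List Formula},
    Typed E (κ.cons M) (F :: Λ) → Typed E (κ'.cons M') (F :: Λ) →
    Eqn E (χ.subst M ++ κ) (χ.subst M' ++ κ') (Γ ++ Λ) →
    Eqn E (κ.cons M) (κ'.cons M') (F :: Λ)

theorem separates_var (A : Formula) : Separates A ⟨0, [.var]⟩ [A] where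
  typed := Typed.var A
  labels := by ext; simp [Cx.mem_labels_mk, Tm.labels]
  cons := by
    intro E κ κ' M M' Λ _ _ e
    simpa [Cx.subst, Cx.append_def, Tm.subst, Cx.cons] using e

/-- This is η for ⊥: `M` is recovered by connecting ⊥ to the term `postp(M)` that the control area
still contains. -/
theorem separates_postp : Separates .bot ⟨{.postp .var}, []⟩ [] where
  typed := Typed.postp_var
  labels := by ext; simp [Cx.mem_labels_mk, Tm.labels]
  cons := by
    intro E κ κ' M M' Λ t t' e
    have e' : Eqn E (κ.addCtrl (.postp M)) (κ'.addCtrl (.postp M')) Λ := by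
      simpa [Cx.subst, Cx.append_def, Tm.subst, Cx.addCtrl] using e
    have b := Eqn.botI (R := Tm.postp M) (R' := Tm.postp M') e'
      (by simp [Cx.Mem, Cx.addCtrl]) (by simp [Cx.Mem, Cx.addCtrl])
    exact (Eqn.botEta t).symm.trans (b.trans (Eqn.botEta t'))

/-- This is η for par. First `casel M` is recovered while `ξ[caser M]` waits in the side context,
then `caser M`, and the two are paired again. The need to keep one half waiting is why separation is
required for every side context. -/
theorem Separates.box {A B : Formula} {ζ ξ : Cx} {Δ Λ : List Formula} (h : Separates A ζ Δ)
    (k : Separates B ξ Λ) :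
    Separates (.par A B) (ζ.subst (.casel .var) ++ ξ.subst (.caser .var)) (Δ ++ Λ) where
  typed := h.typed.box k.typed (apart_of_labels_eq_empty h.labels)
  labels := by
    ext; simp [Cx.mem_labels_append, Cx.mem_labels_subst, h.labels, k.labels, Tm.labels]
  cons := by
    intro E κ κ' M M' Θ t t' e
    have l₂ : ∀ M, (ξ.subst M).tms.length = Λ.length := fun M => by
      simpa [Cx.subst] using k.typed.length
    have key : ∀ {κ : Cx} {M : Tm .m}, Typed E (κ.cons M) (.par A B :: Θ) →
        Typed E ((ξ.subst (.caser M) ++ κ).cons (.casel M)) (A :: (Λ ++ Θ)) ∧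
        Typed E ((κ.cons (.casel M)).cons (.caser M)) (B :: A :: Θ) := by
      intro κ M t
      have v : (⟨0, [.var]⟩ : Cx).labels = ∅ := (separates_var A).labels
      have t₁ := t.parE (Typed.var A) k.typed (apart_of_labels_eq_empty v).symm
        (apart_of_labels_eq_empty k.labels).symm (apart_of_labels_eq_empty v)
      have t₂ := t.parE (Typed.var A) (Typed.var B) (apart_of_labels_eq_empty v).symm
        (apart_of_labels_eq_empty v).symm (apart_of_labels_eq_empty v)
      refine ⟨?_, ?_⟩
      · simpa [Cx.append_def, Cx.subst, Cx.cons, Tm.subst] using t₁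
      · refine Typed.swap_two ?_
        simpa [Cx.append_def, Cx.subst, Cx.cons, Tm.subst] using t₂
    simp only [Cx.append_subst, Cx.subst_subst, Cx.append_assoc, List.append_assoc] at e
    have e₁ := h.cons (key t).1 (key t').1 e
    have l : ∀ {κ : Cx} {M : Tm .m}, Typed E (κ.cons M) (.par A B :: Θ) →
        κ.tms.length = Θ.length := fun t => by simpa [Cx.cons] using t.length
    -- Separation acts at the head of the succedent, so the block of `ξ` is moved in front of the
    -- recovered `casel M`.
    have e₂ : Eqn E (ξ.subst (.caser M) ++ (⟨0, [.casel M]⟩ ++ κ))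
        (ξ.subst (.caser M') ++ (⟨0, [.casel M']⟩ ++ κ')) (Λ ++ ([A] ++ Θ)) := by
      refine Eqn.swap_blocks rfl (l₂ _) (l t) rfl (l₂ _) (l t') ?_
      simpa [Cx.append_def, Cx.cons] using e₁
    have e₃ := k.cons (κ := κ.cons (.casel M)) (κ' := κ'.cons (.casel M')) (Λ := A :: Θ)
      (key t).2 (key t').2 (by simpa [Cx.append_def, Cx.cons] using e₂)
    exact (Eqn.parEta t).symm.trans ((Eqn.parI e₃.swap_two).trans (Eqn.parEta t'))

/-- The class of a context that separates. -/
def Multi.Sep {F : Formula} (χ : Multi F) : Prop := ∃ κ Γ, Multi.Rep χ κ Γ ∧ Separates F κ Γ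

namespace Multi

variable {E F A B : Formula}

theorem sep_one (A : Formula) : Sep (one A) := ⟨_, _, one_rep A, separates_var A⟩

theorem sep_unit : Sep unit := ⟨_, _, unit_rep, separates_postp⟩

theorem Sep.box {χ : Multi A} {μ : Multi B} (h : Sep χ) (k : Sep μ) : Sep (box χ μ) := by
  obtain ⟨ζ, Δ, r, s⟩ := h
  obtain ⟨ξ, Λ, r', s'⟩ := k
  exact ⟨_, _, box_rep r r' (apart_of_labels_eq_empty s.labels), s.box s'⟩

/-- Separation with no further conclusions. A separating context carries no labels, so it is apart
from every representative. -/
theorem Sep.ext {χ : Multi F} (h : Sep χ) {f g : E ⟶ F} (e : act f χ = act g χ) : f = g := by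
  obtain ⟨ζ, Γ, r, s⟩ := h
  obtain ⟨P, M, hf, -⟩ := exists_repBy f Set.finite_empty
  obtain ⟨Q, N, hg, -⟩ := exists_repBy g Set.finite_empty
  have a := act_rep hf r (apart_of_labels_eq_empty s.labels).symm
  have b := act_rep hg r (apart_of_labels_eq_empty s.labels).symm
  rw [← e] at b
  have := s.cons (κ := ⟨P, []⟩) (κ' := ⟨Q, []⟩) (Λ := []) hf.typed hg.typed
    (by simpa only [Cx.comp_mk, List.append_nil] using a.eqn b)
  exact (hf.congr this).eq hg

end Multi

theorem Eqn.append_comm {E : Formula} {κ₁ κ₂ κ₁' κ₂' : Cx} {Γ₁ Γ₂ : List Formula}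
    (h₁ : κ₁.tms.length = Γ₁.length) (h₁' : κ₁'.tms.length = Γ₁.length)
    (t : Eqn E (κ₁ ++ κ₂) (κ₁' ++ κ₂') (Γ₁ ++ Γ₂)) :
    Eqn E (κ₂ ++ κ₁) (κ₂' ++ κ₁') (Γ₂ ++ Γ₁) := by
  have l := t.typed.1.length
  have l' := t.typed.2.length
  simp only [Cx.append_def, List.length_append] at l l'
  have := Eqn.swap_blocks (κ₂ := κ₂) (κ₂' := κ₂') (Γ₂ := Γ₂) (κ₃ := ⟨0, []⟩)
    (κ₃' := ⟨0, []⟩) (Γ₃ := []) h₁ (by omega) rfl h₁'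
    (by omega) rfl (by simpa [Cx.append_def] using t)
  simpa [Cx.append_def] using this

theorem Typed.append_comm {E : Formula} {κ₁ κ₂ : Cx} {Γ₁ Γ₂ : List Formula}
    (h₁ : κ₁.tms.length = Γ₁.length) (t : Typed E (κ₁ ++ κ₂) (Γ₁ ++ Γ₂)) :
    Typed E (κ₂ ++ κ₁) (Γ₂ ++ Γ₁) :=
  (Eqn.append_comm h₁ h₁ (Eqn.refl t)).typed.1

/-! ### The monoidal structure of the syntactic category -/

/-- The morphism given by a typed term in context. -/
def Mor.mk {E F : Formula} (κ : Cx) (h : Typed E κ [F]) : E ⟶ F :=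
  (Quotient.mk (termSetoid E F) ⟨κ, h⟩ : Mor E F)

theorem Mor.mk_rep {E F : Formula} (κ : Cx) (h : Typed E κ [F]) : RepBy (Mor.mk κ h) κ :=
  ⟨h, rfl⟩

theorem labels_var : (⟨0, [.var]⟩ : Cx).labels = ∅ := (separates_var .bot).labels

/-- The tensor product of two contexts with one conclusion. -/
def Cx.tensor (κ ζ : Cx) : Cx :=
  ⟨(κ.subst (.casel .var)).ctrl + (ζ.subst (.caser .var)).ctrl,
    [.par (κ.subst (.casel .var)).out (ζ.subst (.caser .var)).out]⟩

section

variable {E E' F F' A B C : Formula} {κ κ' ζ ζ' ξ : Cx} {Γ Δ Λ : List Formula}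

theorem Typed.tensor (h : Typed E κ [F]) (k : Typed E' ζ [F']) (a : Apart κ ζ) :
    Typed (.par E E') (κ.tensor ζ) [.par F F'] := by
  have t := h.box k a
  rw [h.eq_cons, k.eq_cons] at t ⊢
  exact Typed.parI (κ := ⟨_, []⟩) t

theorem Eqn.tensor (h : Eqn E κ κ' [F]) (k : Eqn E' ζ ζ' [F']) (a : Apart κ ζ)
    (a' : Apart κ' ζ') : Eqn (.par E E') (κ.tensor ζ) (κ'.tensor ζ') [.par F F'] := by
  have t := h.box k a a'
  rw [h.typed.1.eq_cons, k.typed.1.eq_cons, h.typed.2.eq_cons, k.typed.2.eq_cons] at t ⊢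
  exact Eqn.parI (κ := ⟨_, []⟩) (κ' := ⟨_, []⟩) t

end

/-- The action of par on morphisms. -/
def Mor.tensor {E E' F F' : Formula} (f : E ⟶ F) (g : E' ⟶ F') : E.par E' ⟶ F.par F' :=
  Quotient.map₂ (sa := termSetoid E F) (sb := termSetoid E' F')
    (sc := termSetoid (E.par E') (F.par F'))
    (fun (κ : TermIn E F) (ζ : TermIn E' F') =>
      (⟨(κ.1.rename evenL).tensor (ζ.1.rename oddL),
        (κ.2.rename evenL_injective).tensor (ζ.2.rename oddL_injective) (apart_even_odd _ _)⟩ :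
        TermIn (E.par E') (F.par F')))
    (fun κ κ' h ζ ζ' k => Eqn.tensor (Eqn.rename evenL_injective h κ.2 κ'.2)
      (Eqn.rename oddL_injective k ζ.2 ζ'.2) (apart_even_odd _ _) (apart_even_odd _ _)) f g

theorem RepBy.tensor {E E' F F' : Formula} {f : E ⟶ F} {g : E' ⟶ F'} {κ ζ : Cx}
    (h : RepBy f κ) (k : RepBy g ζ) (a : Apart κ ζ) :
    RepBy (Mor.tensor f g) (κ.tensor ζ) := by
  obtain ⟨t, rfl⟩ := h
  obtain ⟨t', rfl⟩ := k
  refine ⟨t.tensor t' a, Quotient.sound ?_⟩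
  exact Eqn.tensor (Eqn.alpha _ evenL_injective t).symm (Eqn.alpha _ oddL_injective t').symm
    (apart_even_odd _ _) a

section

variable (A B C : Formula)

theorem typed_pair : Typed (A.par B) ⟨0, [.casel .var, .caser .var]⟩ [A, B] := by
  simpa [Cx.subst, Cx.append_def, Tm.subst] using
    (Typed.var A).box (Typed.var B) (apart_of_labels_eq_empty labels_var)

theorem typed_triple_left : Typed ((A.par B).par C)
    ⟨0, [.casel (.casel .var), .caser (.casel .var), .caser .var]⟩ [A, B, C] := by
  simpa [Cx.subst, Cx.append_def, Tm.subst] using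
    (typed_pair A B).box (Typed.var C) (apart_of_labels_eq_empty labels_var).symm

theorem typed_triple_right : Typed (A.par (B.par C))
    ⟨0, [.casel .var, .casel (.caser .var), .caser (.caser .var)]⟩ [A, B, C] := by
  simpa [Cx.subst, Cx.append_def, Tm.subst] using
    (Typed.var A).box (typed_pair B C) (apart_of_labels_eq_empty labels_var)

theorem typed_assoc_pair : Typed ((A.par B).par C)
    ⟨0, [.casel (.casel .var), .par (.caser (.casel .var)) (.caser .var)]⟩ [A, B.par C] := by
  have t : Typed ((A.par B).par C)
      (⟨0, [.caser (.casel .var), .caser .var]⟩ ++ ⟨0, [.casel (.casel .var)]⟩)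
      ([B, C] ++ [A]) :=
    Typed.append_comm (κ₁ := ⟨0, [_]⟩) (Γ₁ := [A]) rfl (typed_triple_left A B C)
  exact Typed.swap_two (Typed.parI (κ := ⟨0, [.casel (.casel .var)]⟩) t)

theorem typed_assoc_inv_pair : Typed (A.par (B.par C))
    ⟨0, [.par (.casel .var) (.casel (.caser .var)), .caser (.caser .var)]⟩ [A.par B, C] :=
  Typed.parI (κ := ⟨0, [.caser (.caser .var)]⟩) (typed_triple_right A B C)

theorem typed_leftUnitor : Typed (Formula.bot.par A) ⟨{.postp (.casel .var)}, [.caser .var]⟩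
    [A] := by
  simpa [Cx.subst, Cx.append_def, Tm.subst] using
    Typed.postp_var.box (Typed.var A) (apart_of_labels_eq_empty labels_var).symm

theorem typed_rightUnitor : Typed (A.par .bot) ⟨{.postp (.caser .var)}, [.casel .var]⟩ [A] := by
  simpa [Cx.subst, Cx.append_def, Tm.subst] using
    (Typed.var A).box Typed.postp_var (apart_of_labels_eq_empty labels_var)

theorem typed_conn_pair : Typed A ⟨0, [.conn Tm.var, .var]⟩ [.bot, A] :=
  (Typed.var A).botI (R := Tm.var) (by simp [Cx.Mem])

theorem typed_pair_conn : Typed A ⟨0, [.var, .conn Tm.var]⟩ [A, .bot] :=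
  (typed_conn_pair A).swap_two

/-- The associativity morphism. -/
def assocHom : (A.par B).par C ⟶ A.par (B.par C) :=
  Mor.mk ⟨0, [.par (.casel (.casel .var)) (.par (.caser (.casel .var)) (.caser .var))]⟩
    (Typed.parI (κ := ⟨0, []⟩) (typed_assoc_pair A B C))

/-- The inverse of the associativity morphism. -/
def assocInv : A.par (B.par C) ⟶ (A.par B).par C :=
  Mor.mk ⟨0, [.par (.par (.casel .var) (.casel (.caser .var))) (.caser (.caser .var))]⟩
    (Typed.parI (κ := ⟨0, []⟩) (typed_assoc_inv_pair A B C))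

/-- The left unit morphism. -/
def leftUnitorHom : Formula.bot.par A ⟶ A :=
  Mor.mk ⟨{.postp (.casel .var)}, [.caser .var]⟩ (typed_leftUnitor A)

/-- The inverse of the left unit morphism. -/
def leftUnitorInv : A ⟶ Formula.bot.par A :=
  Mor.mk ⟨0, [.par (.conn Tm.var) .var]⟩ (Typed.parI (κ := ⟨0, []⟩) (typed_conn_pair A))

/-- The right unit morphism. -/
def rightUnitorHom : A.par .bot ⟶ A :=
  Mor.mk ⟨{.postp (.caser .var)}, [.casel .var]⟩ (typed_rightUnitor A)

/-- The inverse of the right unit morphism. -/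
def rightUnitorInv : A ⟶ A.par .bot :=
  Mor.mk ⟨0, [.par .var (.conn Tm.var)]⟩ (Typed.parI (κ := ⟨0, []⟩) (typed_pair_conn A))

/-- The symmetry. -/
def braidHom : A.par B ⟶ B.par A :=
  Mor.mk ⟨0, [.par (.caser .var) (.casel .var)]⟩
    (Typed.parI (κ := ⟨0, []⟩) (typed_pair A B).swap_two)

theorem assocHom_rep : RepBy (assocHom A B C)
    ⟨0, [.par (.casel (.casel .var)) (.par (.caser (.casel .var)) (.caser .var))]⟩ :=
  Mor.mk_rep _ _

theorem assocInv_rep : RepBy (assocInv A B C)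
    ⟨0, [.par (.par (.casel .var) (.casel (.caser .var))) (.caser (.caser .var))]⟩ :=
  Mor.mk_rep _ _

theorem leftUnitorHom_rep : RepBy (leftUnitorHom A) ⟨{.postp (.casel .var)}, [.caser .var]⟩ :=
  Mor.mk_rep _ _

theorem leftUnitorInv_rep : RepBy (leftUnitorInv A) ⟨0, [.par (.conn Tm.var) .var]⟩ :=
  Mor.mk_rep _ _

theorem rightUnitorHom_rep : RepBy (rightUnitorHom A) ⟨{.postp (.caser .var)}, [.casel .var]⟩ :=
  Mor.mk_rep _ _

theorem rightUnitorInv_rep : RepBy (rightUnitorInv A) ⟨0, [.par .var (.conn Tm.var)]⟩ :=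
  Mor.mk_rep _ _

theorem braidHom_rep : RepBy (braidHom A B) ⟨0, [.par (.caser .var) (.casel .var)]⟩ :=
  Mor.mk_rep _ _

end

/-! ### Action of the structural morphisms on juxtapositions -/

namespace Multi

variable {E E' F F' A B C : Formula} {κ κ' ζ ζ' ξ : Cx} {Γ Δ Λ : List Formula}

/-- β for par removes the intermediate pair, leaving `ζ` and `ξ` cut with the two factors taken at
`casel x` and `caser x`. -/
theorem act_tensor (f : E ⟶ F) (g : E' ⟶ F') (χ : Multi F) (μ : Multi F') :
    act (Mor.tensor f g) (box χ μ) = box (act f χ) (act g μ) := by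
  obtain ⟨ζ, Δ, hζ, -⟩ := exists_rep χ Set.finite_empty
  obtain ⟨ξ, Λ, hξ, dξ⟩ := exists_rep μ ζ.finite_labels
  have fS := ζ.finite_labels.union ξ.finite_labels
  obtain ⟨P, M, hf, df⟩ := exists_repBy f fS
  obtain ⟨Q, N, hg, dg⟩ := exists_repBy g (fS.union (Cx.finite_labels ⟨P, [M]⟩))
  have a : Apart ⟨P, [M]⟩ ⟨Q, [N]⟩ := by
    rw [Set.disjoint_union_right] at dg
    exact dg.2.symm
  have t := hf.typed.box hg.typed a
  simp only [Set.disjoint_left] at df dg dξ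
  have l := act_box_rep (hf.tensor hg a) t hζ hξ
    (by
      change Apart (Cx.subst ⟨P, [M]⟩ _ ++ Cx.subst ⟨Q, [N]⟩ _) ζ
      simp only [apart_iff, Cx.mem_labels_append, Cx.mem_labels_subst, Tm.labels, Set.mem_union,
        Set.mem_empty_iff_false] at *
      grind)
    (by
      change Apart (Cx.subst ⟨P, [M]⟩ _ ++ Cx.subst ⟨Q, [N]⟩ _) ξ
      simp only [apart_iff, Cx.mem_labels_append, Cx.mem_labels_subst, Tm.labels, Set.mem_union,
        Set.mem_empty_iff_false] at *
      grind)
    (by simp only [apart_iff]; grind)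
  have r := box_rep (act_rep hf hζ (by simp only [apart_iff, Set.mem_union] at *; grind))
    (act_rep hg hξ (by simp only [apart_iff, Set.mem_union] at *; grind))
    (by
      have hM : ∀ n, n ∈ M.labels → n ∈ Cx.labels ⟨P, [M]⟩ := fun n h => Or.inr ⟨M, by simp, h⟩
      have hN : ∀ n, n ∈ N.labels → n ∈ Cx.labels ⟨Q, [N]⟩ := fun n h => Or.inr ⟨N, by simp, h⟩
      have hP : ∀ n, n ∈ Cx.labels ⟨P, []⟩ → n ∈ Cx.labels ⟨P, [M]⟩ := fun n h => by
        simp only [Cx.mem_labels_mk] at h ⊢; grind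
      have hQ : ∀ n, n ∈ Cx.labels ⟨Q, []⟩ → n ∈ Cx.labels ⟨Q, [N]⟩ := fun n h => by
        simp only [Cx.mem_labels_mk] at h ⊢; grind
      simp only [apart_iff, Cx.comp_mk, Cx.mem_labels_append, Cx.mem_labels_subst, Set.mem_union]
        at *
      grind)
  refine l.eq ?_
  simpa [Cx.comp_mk, Cx.append_def, Cx.subst, Tm.subst_subst, add_left_comm, add_assoc,
    Function.comp_def, Cx.out] using r

/-- The associator has two nested pairs: `act_box_rep` contracts the outer one, a further `parBeta`
the inner one with the block of `ζ` as side context. -/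
theorem act_assoc (χ : Multi A) (μ : Multi B) (ν : Multi C) :
    act (assocHom A B C) (box χ (box μ ν)) = box (box χ μ) ν := by
  obtain ⟨ζ, Δ, hζ, -⟩ := exists_rep χ Set.finite_empty
  obtain ⟨ξ, Λ, hξ, dξ⟩ := exists_rep μ ζ.finite_labels
  obtain ⟨θ, Θ, hθ, dθ⟩ := exists_rep ν (ζ.finite_labels.union ξ.finite_labels)
  simp only [Set.disjoint_left] at dξ dθ
  have l := act_box_rep (assocHom_rep A B C) (typed_assoc_pair A B C) hζ
    (box_rep hξ hθ (by simp [apart_iff] at *; grind))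
    (apart_of_labels_eq_empty (by ext; simp [Cx.mem_labels_mk, Tm.labels]))
    (apart_of_labels_eq_empty (by ext; simp [Cx.mem_labels_mk, Tm.labels]))
    (by
      simp [apart_iff, Cx.mem_labels_append, Cx.mem_labels_subst, Tm.labels] at *
      grind)
  have r := box_rep (box_rep hζ hξ (by simp [apart_iff] at *; grind)) hθ
    (by
      simp [apart_iff, Cx.mem_labels_append, Cx.mem_labels_subst, Tm.labels] at *
      grind)
  have t := Typed.cut (κ := ⟨0, [.caser (.casel .var), .caser .var]⟩) (typed_triple_left A B C)
    hζ.typed (apart_of_labels_eq_empty (by ext; simp [Cx.cons, Cx.mem_labels_mk, Tm.labels]))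
  have lζ := hζ.typed.length
  have lξ := hξ.typed.length
  have lθ := hθ.typed.length
  have t' := t.append_comm (by simpa [Cx.subst] using lζ)
  have e := Eqn.parBeta (κ := ζ.subst (.casel (.casel .var))) (M := .caser (.casel .var))
    (N := .caser .var) (Γ := Δ) (by simpa [Cx.append_def, Cx.cons] using t') hξ.typed hθ.typed
    (by
      simp [apart_iff, Cx.mem_labels_cons, Cx.mem_labels_subst, Tm.labels] at *
      grind)
    (by
      simp [apart_iff, Cx.mem_labels_cons, Cx.mem_labels_subst, Tm.labels] at *
      grind)
    (by simp [apart_iff] at *; grind)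
  -- The inner redex had to stand at the head; the block of `ζ` is now brought back to the front.
  rw [← Cx.append_assoc, ← Cx.append_assoc, ← List.append_assoc] at e
  have e' := e.append_comm (by simp [Cx.append_def, Cx.subst, lξ, lθ])
    (by simp [Cx.append_def, Cx.subst, lξ, lθ])
  have l' := l.congr (by
    simpa [Cx.append_def, Cx.subst, Tm.subst_subst, Function.comp_def, Tm.subst] using e')
  refine l'.eq ?_
  simpa [Cx.append_def, Cx.subst, Tm.subst_subst, Function.comp_def, Tm.subst, add_assoc] using r

theorem act_assocInv (χ : Multi A) (μ : Multi B) (ν : Multi C) :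
    act (assocInv A B C) (box (box χ μ) ν) = box χ (box μ ν) := by
  obtain ⟨ζ, Δ, hζ, -⟩ := exists_rep χ Set.finite_empty
  obtain ⟨ξ, Λ, hξ, dξ⟩ := exists_rep μ ζ.finite_labels
  obtain ⟨θ, Θ, hθ, dθ⟩ := exists_rep ν (ζ.finite_labels.union ξ.finite_labels)
  simp only [Set.disjoint_left] at dξ dθ
  have l := act_box_rep (assocInv_rep A B C) (typed_assoc_inv_pair A B C)
    (box_rep hζ hξ (by simp [apart_iff] at *; grind)) hθ
    (apart_of_labels_eq_empty (by ext; simp [Cx.mem_labels_mk, Tm.labels]))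
    (apart_of_labels_eq_empty (by ext; simp [Cx.mem_labels_mk, Tm.labels]))
    (by
      simp [apart_iff, Cx.mem_labels_append, Cx.mem_labels_subst, Tm.labels] at *
      grind)
  have r := box_rep hζ (box_rep hξ hθ (by simp [apart_iff] at *; grind))
    (by
      simp [apart_iff, Cx.mem_labels_append, Cx.mem_labels_subst, Tm.labels] at *
      grind)
  have lθ := hθ.typed.length
  -- Here the inner pair is the first component, so exchange serves only to type the side context
  -- coming from `θ`.
  have s : Typed (A.par (B.par C))
      (⟨0, [.caser (.caser .var)]⟩ ++ ⟨0, [.casel .var, .casel (.caser .var)]⟩) ([C] ++ [A, B]) :=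
    Typed.append_comm (κ₁ := ⟨0, [_, _]⟩) (Γ₁ := [A, B]) rfl (typed_triple_right A B C)
  have t := Typed.cut (κ := ⟨0, [.casel .var, .casel (.caser .var)]⟩) s
    hθ.typed (apart_of_labels_eq_empty (by ext; simp [Cx.cons, Cx.mem_labels_mk, Tm.labels]))
  have t' := t.append_comm (by simpa [Cx.subst] using lθ)
  have e := Eqn.parBeta (κ := θ.subst (.caser (.caser .var))) (M := .casel .var)
    (N := .casel (.caser .var)) (Γ := Θ) (by simpa [Cx.append_def, Cx.cons] using t')
    hζ.typed hξ.typed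
    (by
      simp [apart_iff, Cx.mem_labels_cons, Cx.mem_labels_subst, Tm.labels] at *
      grind)
    (by
      simp [apart_iff, Cx.mem_labels_cons, Cx.mem_labels_subst, Tm.labels] at *
      grind)
    (by simp [apart_iff] at *; grind)
  have l' := l.congr (by
    simpa [Cx.append_def, Cx.subst, Tm.subst_subst, Function.comp_def, Tm.subst, add_assoc] using e)
  refine l'.eq ?_
  simpa [Cx.append_def, Cx.subst, Tm.subst_subst, Function.comp_def, Tm.subst, add_assoc] using r

theorem act_leftUnitor (χ : Multi A) : act (leftUnitorHom A) χ = box unit χ := by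
  obtain ⟨ζ, Δ, hζ, -⟩ := exists_rep χ Set.finite_empty
  have l := act_rep (leftUnitorHom_rep A) hζ
    (apart_of_labels_eq_empty (by ext; simp [Cx.mem_labels_mk, Tm.labels]))
  refine l.eq ?_
  have r := box_rep unit_rep hζ (apart_of_labels_eq_empty separates_postp.labels)
  simpa [Cx.comp_mk, Cx.append_def, Cx.subst, Tm.subst, add_comm] using r

theorem act_rightUnitor (χ : Multi A) : act (rightUnitorHom A) χ = box χ unit := by
  obtain ⟨ζ, Δ, hζ, -⟩ := exists_rep χ Set.finite_empty
  have l := act_rep (rightUnitorHom_rep A) hζ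
    (apart_of_labels_eq_empty (by ext; simp [Cx.mem_labels_mk, Tm.labels]))
  refine l.eq ?_
  have r := box_rep hζ unit_rep (apart_of_labels_eq_empty separates_postp.labels).symm
  simpa [Cx.comp_mk, Cx.append_def, Cx.subst, Tm.subst] using r

/-- The variable need not be a member of `ζ`, so β for ⊥ does not apply directly. It is applied to
the axiom, where the variable is the conclusion, and then cut with `ζ`. -/
theorem eqn_postp_conn {χ : Multi A} (hζ : Rep χ ζ Δ) :
    Eqn A (ζ ++ ⟨{.postp (.conn Tm.var)}, []⟩) ζ Δ := by
  have e := Eqn.botBeta (Typed.var A) (R := Tm.var) (by simp [Cx.Mem])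
  have := Eqn.compMulti e (Eqn.refl hζ.typed)
    (apart_of_labels_eq_empty (by ext; simp [Cx.addCtrl, Cx.mem_labels_mk, Tm.labels]))
    (apart_of_labels_eq_empty labels_var)
  simpa [Cx.addCtrl, Cx.comp_mk, Cx.subst_var, Cx.append_def] using this

theorem act_leftUnitorInv (χ : Multi A) : act (leftUnitorInv A) (box unit χ) = χ := by
  obtain ⟨ζ, Δ, hζ, -⟩ := exists_rep χ Set.finite_empty
  have l := act_box_rep (leftUnitorInv_rep A) (typed_conn_pair A) unit_rep hζ
    (apart_of_labels_eq_empty (by ext; simp [Cx.mem_labels_mk, Tm.labels]))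
    (apart_of_labels_eq_empty (by ext; simp [Cx.mem_labels_mk, Tm.labels]))
    (apart_of_labels_eq_empty separates_postp.labels)
  refine (l.congr ?_).eq hζ
  simpa [Cx.append_def, Cx.subst, Tm.subst, Tm.subst_var, add_comm] using eqn_postp_conn hζ

theorem act_rightUnitorInv (χ : Multi A) : act (rightUnitorInv A) (box χ unit) = χ := by
  obtain ⟨ζ, Δ, hζ, -⟩ := exists_rep χ Set.finite_empty
  have l := act_box_rep (rightUnitorInv_rep A) (typed_pair_conn A) hζ unit_rep
    (apart_of_labels_eq_empty (by ext; simp [Cx.mem_labels_mk, Tm.labels]))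
    (apart_of_labels_eq_empty (by ext; simp [Cx.mem_labels_mk, Tm.labels]))
    (apart_of_labels_eq_empty separates_postp.labels).symm
  rw [List.append_nil] at l
  refine (l.congr ?_).eq hζ
  simpa [Cx.append_def, Cx.subst, Tm.subst, Tm.subst_var] using eqn_postp_conn hζ

/-- Conclusions keep their order while the projections they use are interchanged. Such a term is not
displayed as a box, hence a statement about representatives. -/
theorem act_braid_rep {χ : Multi B} {μ : Multi A} (hζ : Rep χ ζ Δ) (hξ : Rep μ ξ Λ)
    (a : Apart ζ ξ) :
    Rep (act (braidHom A B) (box χ μ)) (ζ.subst (.caser .var) ++ ξ.subst (.casel .var))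
      (Δ ++ Λ) := by
  have l := act_box_rep (braidHom_rep A B) (typed_pair A B).swap_two hζ hξ
    (apart_of_labels_eq_empty (by ext; simp [Cx.mem_labels_mk, Tm.labels]))
    (apart_of_labels_eq_empty (by ext; simp [Cx.mem_labels_mk, Tm.labels])) a
  simpa [Cx.append_def] using l

end Multi

/-! ### Exchange and decompositions into variables -/

namespace Multi

variable {E F A B C : Formula}

/-- The class of a typed term in context. -/
def mk (κ : Cx) (Γ : List Formula) (h : Typed E κ Γ) : Multi E := Quotient.mk _ ⟨κ, Γ, h⟩

theorem mk_rep (κ : Cx) (Γ : List Formula) (h : Typed E κ Γ) : Rep (mk κ Γ h) κ Γ := ⟨h, rfl⟩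

/-- Precomposition commutes with exchange. -/
theorem act_exch_rep {f : E ⟶ F} {χ μ : Multi F} {P P' : Multiset (Tm .p)}
    {Ms Ns Ms' Ns' : List (Tm .m)} {M N M' N' : Tm .m} {Γ Δ : List Formula}
    (hl : Ms.length = Γ.length) (hl' : Ms'.length = Γ.length)
    (h : Rep χ ⟨P, Ms ++ M :: N :: Ns⟩ (Γ ++ A :: B :: Δ))
    (k : Rep (act f χ) ⟨P', Ms' ++ M' :: N' :: Ns'⟩ (Γ ++ A :: B :: Δ))
    (h' : Rep μ ⟨P, Ms ++ N :: M :: Ns⟩ (Γ ++ B :: A :: Δ)) :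
    Rep (act f μ) ⟨P', Ms' ++ N' :: M' :: Ns'⟩ (Γ ++ B :: A :: Δ) := by
  obtain ⟨Q, L, hf, d⟩ := exists_repBy f (Cx.finite_labels ⟨P, Ms ++ M :: N :: Ns⟩)
  have e : Cx.labels ⟨P, Ms ++ M :: N :: Ns⟩ = Cx.labels ⟨P, Ms ++ N :: M :: Ns⟩ := by
    ext n
    simp only [Cx.mem_labels_mk, List.mem_append, List.mem_cons]
    grind
  have l := (act_rep hf h d).eqn k
  have r := act_rep hf h' (by rw [e] at d; exact d)
  refine r.congr ?_
  simp only [Cx.comp_mk, Cx.subst, Cx.append_def, List.map_append, List.map_cons, List.append_nil]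
    at l ⊢
  exact Eqn.exch (by simpa using hl) hl' l

theorem act_one_rep {f : E ⟶ F} {P : Multiset (Tm .p)} {M : Tm .m} (h : RepBy f ⟨P, [M]⟩) :
    Rep (act f (one F)) ⟨P, [M]⟩ [F] := by
  have := act_rep h (one_rep F) (apart_of_labels_eq_empty labels_var).symm
  simpa [Cx.comp_mk, Cx.subst, Cx.append_def, Tm.subst] using this

theorem box_one_one_rep (A B : Formula) :
    Rep (box (one A) (one B)) ⟨0, [.casel .var, .caser .var]⟩ [A, B] := by
  simpa [Cx.subst, Cx.append_def, Tm.subst] using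
    box_rep (one_rep A) (one_rep B) (apart_of_labels_eq_empty labels_var)

theorem act_braid_one (A B : Formula) :
    Rep (act (braidHom A B) (box (one B) (one A))) ⟨0, [.caser .var, .casel .var]⟩ [B, A] := by
  simpa [Cx.subst, Cx.append_def, Tm.subst] using
    act_braid_rep (one_rep B) (one_rep A) (apart_of_labels_eq_empty labels_var)

theorem triple_right_rep (A B C : Formula) : Rep (box (one A) (box (one B) (one C)))
    ⟨0, [.casel .var, .casel (.caser .var), .caser (.caser .var)]⟩ [A, B, C] := by
  simpa [Cx.subst, Cx.append_def, Tm.subst] using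
    box_rep (one_rep A) (box_one_one_rep B C) (apart_of_labels_eq_empty labels_var)

theorem triple_left_rep (A B C : Formula) : Rep (box (box (one A) (one B)) (one C))
    ⟨0, [.casel (.casel .var), .caser (.casel .var), .caser .var]⟩ [A, B, C] := by
  simpa [Cx.subst, Cx.append_def, Tm.subst] using
    box_rep (box_one_one_rep A B) (one_rep C) (apart_of_labels_eq_empty labels_var).symm

end Multi

open Multi

/-! ### Coherence laws of the syntactic category -/

theorem sep_two (A B : Formula) : Sep (box (one A) (one B)) := (sep_one A).box (sep_one B)

theorem sep_three (A B C : Formula) : Sep (box (one A) (box (one B) (one C))) :=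
  (sep_one A).box (sep_two B C)

theorem assoc_hom_inv (A B C : Formula) : assocHom A B C ≫ assocInv A B C = 𝟙 _ := by
  refine ((sep_two A B).box (sep_one C)).ext ?_
  rw [act_comp, act_assocInv, act_assoc, act_id]

theorem assoc_inv_hom (A B C : Formula) : assocInv A B C ≫ assocHom A B C = 𝟙 _ := by
  refine (sep_three A B C).ext ?_
  rw [act_comp, act_assoc, act_assocInv, act_id]

theorem leftUnitor_hom_inv (A : Formula) : leftUnitorHom A ≫ leftUnitorInv A = 𝟙 _ := by
  refine (sep_unit.box (sep_one A)).ext ?_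
  rw [act_comp, act_leftUnitorInv, act_leftUnitor, act_id]

theorem leftUnitor_inv_hom (A : Formula) : leftUnitorInv A ≫ leftUnitorHom A = 𝟙 _ := by
  refine (sep_one A).ext ?_
  rw [act_comp, act_leftUnitor, act_leftUnitorInv, act_id]

theorem rightUnitor_hom_inv (A : Formula) : rightUnitorHom A ≫ rightUnitorInv A = 𝟙 _ := by
  refine ((sep_one A).box sep_unit).ext ?_
  rw [act_comp, act_rightUnitorInv, act_rightUnitor, act_id]

theorem rightUnitor_inv_hom (A : Formula) : rightUnitorInv A ≫ rightUnitorHom A = 𝟙 _ := by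
  refine (sep_one A).ext ?_
  rw [act_comp, act_rightUnitor, act_rightUnitorInv, act_id]

theorem braid_braid (A B : Formula) : braidHom A B ≫ braidHom B A = 𝟙 _ := by
  refine (sep_two A B).ext ?_
  rw [act_comp, act_id]
  have h := act_exch_rep (f := braidHom A B) (Ms := []) (Ms' := []) (Γ := []) (Δ := [])
    (Ns := []) (Ns' := []) rfl rfl (box_one_one_rep B A) (act_braid_one A B)
    (act_braid_one B A)
  exact h.eq (box_one_one_rep A B)

theorem braid_naturality {A A' B B' : Formula} (f : A ⟶ A') (g : B ⟶ B') :
    Mor.tensor f g ≫ braidHom A' B' = braidHom A B ≫ Mor.tensor g f := by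
  refine (sep_two B' A').ext ?_
  rw [act_comp, act_comp, act_tensor]
  obtain ⟨P, M, hf, -⟩ := exists_repBy f Set.finite_empty
  obtain ⟨Q, N, hg, d⟩ := exists_repBy g (Cx.finite_labels ⟨P, [M]⟩)
  have rf := act_one_rep hf
  have rg := act_one_rep hg
  have r := act_braid_rep rg rf d
  have l := act_exch_rep (f := Mor.tensor f g) (Ms := []) (Ms' := []) (Γ := []) (Δ := [])
    (Ns := []) (Ns' := []) rfl rfl (box_one_one_rep A' B')
    (by rw [act_tensor]; exact box_rep rf rg (Apart.symm d)) (act_braid_one A' B')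
  refine l.eq ?_
  simpa [Cx.append_def, Cx.subst, add_comm] using r

/-- Tested on the decomposition `B, C, A`, both composites return the list `caser (casel x)`, `caser
x`, `casel (casel x)`. -/
theorem hexagon (A B C : Formula) :
    assocHom A B C ≫ braidHom A (B.par C) ≫ assocHom B C A =
      Mor.tensor (braidHom A B) (𝟙 C) ≫ assocHom B A C ≫ Mor.tensor (𝟙 B) (braidHom A C) := by
  refine (sep_three B C A).ext ?_
  simp only [act_comp]
  rw [act_assoc, act_tensor, act_id]
  have t := typed_triple_right A B C
  have b₁ := act_braid_rep (box_one_one_rep B C) (one_rep A) (apart_of_labels_eq_empty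
    (by ext; simp [Cx.mem_labels_mk, Tm.labels]))
  -- The formula `A` passes `B` here and `C` in `r₂`.
  have r₁ := act_exch_rep (f := assocHom A B C) (Ms := []) (Ms' := []) (Γ := [])
    rfl rfl (triple_right_rep A B C)
    (by rw [act_assoc]; exact triple_left_rep A B C) (mk_rep _ _ t.swap_two)
  have r₂ := act_exch_rep (f := assocHom A B C) (Ms := [.casel (.caser .var)])
    (Ms' := [.caser (.casel .var)]) (Γ := [B]) (Δ := []) (Ns := []) (Ns' := [])
    rfl rfl (mk_rep _ _ t.swap_two) r₁ b₁
  have b₂ := box_rep (one_rep B) (act_braid_one A C) (apart_of_labels_eq_empty labels_var)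
  have s₁ := act_exch_rep (f := assocHom B A C) (Ms := [.casel .var])
    (Ms' := [.casel (.casel .var)]) (Γ := [B]) (Δ := []) (Ns := []) (Ns' := [])
    rfl rfl (triple_right_rep B A C)
    (by rw [act_assoc]; exact triple_left_rep B A C) b₂
  have b₃ := box_rep (act_braid_one A B) (one_rep C) (apart_of_labels_eq_empty labels_var).symm
  have s₂ := act_exch_rep (f := Mor.tensor (braidHom A B) (𝟙 C)) (Ms := [.casel (.casel .var)])
    (Ms' := [.caser (.casel .var)]) (Γ := [B]) (Δ := []) (Ns := []) (Ns' := [])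
    rfl rfl (triple_left_rep B A C) (by rw [act_tensor, act_id]; exact b₃) s₁
  exact r₂.eq s₂

/-- The monoidal structure of the syntactic category. -/
@[reducible] def monoidalStruct : MonoidalCategoryStruct Formula where
  tensorObj := Formula.par
  tensorHom := Mor.tensor
  whiskerLeft X _ _ f := Mor.tensor (𝟙 X) f
  whiskerRight f Y := Mor.tensor f (𝟙 Y)
  tensorUnit := Formula.bot
  associator A B C := ⟨assocHom A B C, assocInv A B C, assoc_hom_inv A B C, assoc_inv_hom A B C⟩
  leftUnitor A :=
    ⟨leftUnitorHom A, leftUnitorInv A, leftUnitor_hom_inv A, leftUnitor_inv_hom A⟩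
  rightUnitor A :=
    ⟨rightUnitorHom A, rightUnitorInv A, rightUnitor_hom_inv A, rightUnitor_inv_hom A⟩

attribute [local instance] monoidalStruct

/-- The syntactic category is monoidal. -/
@[reducible] def monoidal : MonoidalCategory Formula := MonoidalCategory.ofTensorHom
  (id_tensorHom_id := fun A B => (sep_two A B).ext (by
    change act (Mor.tensor _ _) _ = act (𝟙 (A.par B)) _
    simp only [act_tensor, act_id]))
  (id_tensorHom := fun _ _ _ _ => rfl)
  (tensorHom_id := fun _ _ => rfl)
  (tensorHom_comp_tensorHom := fun {_ _ A _ _ B} f f' g g' => (sep_two A B).ext (by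
    change act (Mor.tensor _ _ ≫ Mor.tensor _ _) _ = act (Mor.tensor _ _) _
    simp only [act_tensor, act_comp]))
  (associator_naturality := fun {_ _ _ A B C} f g h => (sep_three A B C).ext (by
    change act (Mor.tensor (Mor.tensor _ _) _ ≫ assocHom _ _ _) _ =
      act (assocHom _ _ _ ≫ Mor.tensor _ (Mor.tensor _ _)) _
    simp only [act_comp, act_assoc, act_tensor]))
  (leftUnitor_naturality := fun {_ B} f => (sep_one B).ext (by
    change act (Mor.tensor (𝟙 Formula.bot) _ ≫ leftUnitorHom _) _ = act (leftUnitorHom _ ≫ _) _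
    simp only [act_comp, act_leftUnitor, act_tensor, act_id]))
  (rightUnitor_naturality := fun {_ B} f => (sep_one B).ext (by
    change act (Mor.tensor _ (𝟙 Formula.bot) ≫ rightUnitorHom _) _ = act (rightUnitorHom _ ≫ _) _
    simp only [act_comp, act_rightUnitor, act_tensor, act_id]))
  (pentagon := fun A B C D => ((sep_one A).box (sep_three B C D)).ext (by
    change act (Mor.tensor (assocHom _ _ _) (𝟙 _) ≫ assocHom _ _ _ ≫
      Mor.tensor (𝟙 _) (assocHom _ _ _)) _ = act (assocHom _ _ _ ≫ assocHom _ _ _) _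
    simp only [act_comp, act_assoc, act_tensor, act_id]))
  (triangle := fun A B => (sep_two A B).ext (by
    change act (assocHom _ Formula.bot _ ≫ Mor.tensor (𝟙 _) (leftUnitorHom _)) _ =
      act (Mor.tensor (rightUnitorHom _) (𝟙 _)) _
    simp only [act_comp, act_assoc, act_tensor, act_id, act_leftUnitor, act_rightUnitor]))

attribute [local instance] monoidal

/-- The symmetry being its own inverse, this is the inverse of the forward hexagon for `C, A, B`. -/
theorem hexagon_reverse_of_forward {A B C : Formula} :
    assocInv A B C ≫ braidHom (A.par B) C ≫ assocInv C A B =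
      Mor.tensor (𝟙 A) (braidHom B C) ≫ assocInv A C B ≫ Mor.tensor (braidHom A C) (𝟙 B) := by
  let β (X Y : Formula) : X ⊗ Y ≅ Y ⊗ X :=
    ⟨braidHom X Y, braidHom Y X, braid_braid X Y, braid_braid Y X⟩
  have e : α_ C A B ≪≫ β C (A ⊗ B) ≪≫ α_ A B C =
      whiskerRightIso (β C A) B ≪≫ α_ A C B ≪≫ whiskerLeftIso A (β C B) :=
    Iso.ext (hexagon C A B)
  have := congrArg Iso.inv e
  simp only [Iso.trans_inv, Category.assoc] at this
  exact this

/-- The syntactic category is symmetric monoidal. -/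
@[reducible] def symmetric : SymmetricCategory Formula where
  braiding A B := ⟨braidHom A B, braidHom B A, braid_braid A B, braid_braid B A⟩
  braiding_naturality_right A _ _ f := braid_naturality (𝟙 A) f
  braiding_naturality_left f B := braid_naturality f (𝟙 B)
  hexagon_forward A B C := hexagon A B C
  hexagon_reverse _ _ _ := hexagon_reverse_of_forward
  symmetry A B := braid_braid A B

attribute [local instance] symmetric

/-! ### Subtraction is left adjoint to par -/

theorem Typed.parE_pair {E A B : Formula} {κ : Cx} {M : Tm .m} {Γ : List Formula}
    (t : Typed E (κ.cons M) (.par A B :: Γ)) :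
    Typed E ((κ.cons (.caser M)).cons (.casel M)) (A :: B :: Γ) := by
  have := t.parE (Typed.var A) (Typed.var B) (apart_of_labels_eq_empty labels_var).symm
    (apart_of_labels_eq_empty labels_var).symm (apart_of_labels_eq_empty labels_var)
  simpa [Cx.append_def, Cx.subst, Cx.cons, Tm.subst] using this

theorem Eqn.parE_pair {E A B : Formula} {κ κ' : Cx} {M M' : Tm .m} {Γ : List Formula}
    (t : Eqn E (κ.cons M) (κ'.cons M') (.par A B :: Γ)) :
    Eqn E ((κ.cons (.caser M)).cons (.casel M)) ((κ'.cons (.caser M')).cons (.casel M'))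
      (A :: B :: Γ) := by
  have := t.parE (Eqn.refl (Typed.var A)) (Eqn.refl (Typed.var B))
    (apart_of_labels_eq_empty labels_var).symm (apart_of_labels_eq_empty labels_var).symm
    (apart_of_labels_eq_empty labels_var) (apart_of_labels_eq_empty labels_var).symm
    (apart_of_labels_eq_empty labels_var).symm (apart_of_labels_eq_empty labels_var)
  simpa [Cx.append_def, Cx.subst, Cx.cons, Tm.subst] using this

theorem Eqn.parBeta_pair {E A B : Formula} {κ : Cx} {M N : Tm .m} {Γ : List Formula}
    (t : Typed E ((κ.cons N).cons M) (A :: B :: Γ)) :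
    Eqn E ((κ.cons (.caser (.par M N))).cons (.casel (.par M N))) ((κ.cons N).cons M)
      (A :: B :: Γ) := by
  have := Eqn.parBeta t (Typed.var A) (Typed.var B)
    (apart_of_labels_eq_empty labels_var).symm (apart_of_labels_eq_empty labels_var).symm
    (apart_of_labels_eq_empty labels_var)
  simpa [Cx.append_def, Cx.subst, Cx.cons, Tm.subst] using this

/-- By η for par, a morphism into a par is the pair of its components. -/
theorem repBy_of_act_pair {E A B : Formula} {f : E ⟶ A.par B} {P : Multiset (Tm .p)}
    {M N : Tm .m} (h : Rep (act f (box (one A) (one B))) ⟨P, [M, N]⟩ [A, B]) :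
    RepBy f ⟨P, [.par M N]⟩ := by
  obtain ⟨Q, L, hf, -⟩ := exists_repBy f Set.finite_empty
  have r := act_rep hf (box_one_one_rep A B)
    (apart_of_labels_eq_empty (by ext; simp [Cx.mem_labels_mk, Tm.labels])).symm
  have e : Eqn E ⟨Q, [.casel L, .caser L]⟩ ⟨P, [M, N]⟩ [A, B] := by
    simpa [Cx.comp_mk, Cx.append_def, Cx.subst, Tm.subst] using r.eqn h
  exact hf.congr ((Eqn.parEta (κ := ⟨Q, []⟩) hf.typed).symm.trans
    (Eqn.parI (κ := ⟨Q, []⟩) (κ' := ⟨P, []⟩) e))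

theorem act_pair_rep {E A B : Formula} {f : E ⟶ A.par B} {P : Multiset (Tm .p)} {M : Tm .m}
    (h : RepBy f ⟨P, [M]⟩) :
    Rep (act f (box (one A) (one B))) ⟨P, [.casel M, .caser M]⟩ [A, B] := by
  have r := act_rep h (box_one_one_rep A B)
    (apart_of_labels_eq_empty (by ext; simp [Cx.mem_labels_mk, Tm.labels])).symm
  simpa [Cx.comp_mk, Cx.append_def, Cx.subst, Tm.subst] using r

theorem typed_coeval (A C : Formula) (y : ℕ) :
    Typed C ⟨0, [.app y .var, .mkc .var y]⟩ [A, C.sub A] :=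
  ((Typed.var C).subI (κ := ⟨0, []⟩) y (Typed.var A)
    (apart_of_labels_eq_empty labels_var)
    (by simp [Fresh, Cx.mem_labels_mk, Tm.labels, Cx.cons])
    (by simp [Fresh, Cx.mem_labels_mk, Tm.labels])).swap_two

/-- The unit of the adjunction. -/
def coeval (A C : Formula) : C ⟶ A ⊗ C.sub A :=
  Mor.mk ⟨0, [.par (.app 0 .var) (.mkc .var 0)]⟩ (Typed.parI (κ := ⟨0, []⟩) (typed_coeval A C 0))

/-- The label `0` of the definition is immaterial: swapping it with `y` is an injective renaming. -/
theorem coeval_rep (A C : Formula) (y : ℕ) :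
    RepBy (coeval A C) ⟨0, [.par (.app y .var) (.mkc .var y)]⟩ := by
  have h : RepBy (coeval A C) ⟨0, [.par (.app 0 .var) (.mkc .var 0)]⟩ := Mor.mk_rep _ _
  simpa [Cx.rename, Tm.rename] using h.rename (Equiv.swap 0 y).injective

/-- From `P | M : A ⅋ B` with input of type `C`, the term
`postp(z ↦ casel M, x), P[z(x)] | caser M[z(x)] : B` with input of type `C ∖ A`. -/
def Cx.uncurry (z : ℕ) (κ : Cx) : Cx :=
  ((⟨κ.ctrl, [.caser κ.out]⟩ : Cx).subst (.app z .var)).addCtrl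
    (.postpone z (.casel κ.out) .var)

theorem Cx.mem_labels_uncurry {n z : ℕ} {P : Multiset (Tm .p)} {M : Tm .m} :
    n ∈ (Cx.uncurry z ⟨P, [M]⟩).labels ↔ n = z ∨ n ∈ Cx.labels ⟨P, [M]⟩ := by
  simp only [uncurry, mem_labels_addCtrl, mem_labels_subst, Tm.labels, out, mem_labels_mk]
  simp [Tm.labels]
  grind

theorem Cx.uncurry_rename (r : ℕ → ℕ) (z : ℕ) (P : Multiset (Tm .p)) (M : Tm .m) :
    (Cx.uncurry z ⟨P, [M]⟩).rename r = Cx.uncurry (r z) (Cx.rename r ⟨P, [M]⟩) := by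
  simp [uncurry, rename, addCtrl, subst, out, Tm.rename, Tm.rename_subst, Tm.subst,
    Function.comp_def]

/-- The transpose is an instance of subtraction elimination at a variable of type `C ∖ A`, the right
premise being split into `casel` (postponed) and `caser`. Compatibility of that rule gives the
claim. -/
theorem Eqn.uncurry {C A B : Formula} {κ κ' : Cx} {z : ℕ} (h : Eqn C κ κ' [A.par B])
    (hz : Fresh z κ) (hz' : Fresh z κ') :
    Eqn (C.sub A) (κ.uncurry z) (κ'.uncurry z) [B] := by
  have e := h.typed.1.eq_cons
  have e' := h.typed.2.eq_cons
  rw [e, e'] at h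
  rw [e] at hz ⊢
  rw [e'] at hz' ⊢
  have k := h.parE_pair
  have f : ∀ {κ : Cx}, Fresh z ((⟨κ.ctrl, []⟩ : Cx).cons κ.out) →
      Fresh z (((⟨κ.ctrl, []⟩ : Cx).cons (.caser κ.out)).cons (.casel κ.out)) := by
    intro κ h
    simp only [Fresh, Cx.mem_labels_cons, Tm.labels] at *
    grind
  have := Eqn.subE (κ := ⟨0, []⟩) (κ' := ⟨0, []⟩) z (Eqn.refl (Typed.var (C.sub A))) k
    (apart_of_labels_eq_empty labels_var) (apart_of_labels_eq_empty labels_var)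
    (by simp [Fresh, Cx.mem_labels_mk, Tm.labels, Cx.cons]) (f hz)
    (by simp [Fresh, Cx.mem_labels_mk, Tm.labels, Cx.cons]) (f hz')
  simpa [Cx.append_def, Cx.uncurry, Cx.cons, Cx.out, Cx.subst] using this

theorem Typed.uncurry {C A B : Formula} {κ : Cx} {z : ℕ} (h : Typed C κ [A.par B])
    (hz : Fresh z κ) : Typed (C.sub A) (κ.uncurry z) [B] :=
  ((Eqn.refl h).uncurry hz hz).typed.1

/-- Shifting labels by one frees `0` for the binder of the transpose. -/
theorem fresh_zero_succ (κ : Cx) : Fresh 0 (κ.rename Nat.succ) := by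
  simp [Fresh, Cx.labels_rename]

/-- The transpose of `C ⟶ A ⅋ B`. -/
def Mor.uncurry {C A B : Formula} (f : C ⟶ A ⊗ B) : C.sub A ⟶ B :=
  Quotient.map (sa := termSetoid C (A.par B)) (sb := termSetoid (C.sub A) B)
    (fun (κ : TermIn C (A.par B)) =>
      (⟨(κ.1.rename Nat.succ).uncurry 0,
        (κ.2.rename Nat.succ_injective).uncurry (fresh_zero_succ _)⟩ : TermIn (C.sub A) B))
    (fun κ κ' h => Eqn.uncurry (Eqn.rename Nat.succ_injective h κ.2 κ'.2)
      (fresh_zero_succ _) (fresh_zero_succ _)) f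

theorem RepBy.uncurry {C A B : Formula} {f : C ⟶ A ⊗ B} {P : Multiset (Tm .p)} {M : Tm .m}
    {z : ℕ} (h : RepBy f ⟨P, [M]⟩) (hz : Fresh z ⟨P, [M]⟩) :
    RepBy (Mor.uncurry f) (Cx.uncurry z ⟨P, [M]⟩) := by
  obtain ⟨t, rfl⟩ := h
  refine ⟨t.uncurry hz, Quotient.sound ?_⟩
  have t' : Typed C (Cx.rename Nat.succ ⟨P, [M]⟩) [A.par B] := t.rename Nat.succ_injective
  -- The swap carries the binder `0` of the definition to the prescribed `z`.
  have hr := (Equiv.swap 0 z).injective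
  have a := Eqn.alpha (Equiv.swap 0 z) hr (t'.uncurry (fresh_zero_succ ⟨P, [M]⟩))
  have b := Eqn.uncurry (z := z) ((Eqn.alpha _ Nat.succ_injective t).trans (Eqn.alpha _ hr t')) hz
    (by simpa using (fresh_zero_succ ⟨P, [M]⟩).rename hr)
  refine Eqn.trans a (Eqn.trans ?_ b.symm)
  have e : ((Cx.rename Nat.succ ⟨P, [M]⟩).uncurry 0).rename (Equiv.swap 0 z) =
      ((Cx.rename Nat.succ ⟨P, [M]⟩).rename (Equiv.swap 0 z)).uncurry z := by
    have := Cx.uncurry_rename (Equiv.swap 0 z) 0 (Cx.rename Nat.succ ⟨P, [M]⟩).ctrl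
      (M.rename Nat.succ)
    rwa [Equiv.swap_apply_left] at this
  rw [e]
  exact Eqn.refl (b.typed.2)

theorem act_coeval_rep {A C : Formula} {χ : Multi A} {μ : Multi (C.sub A)} {ζ ξ : Cx}
    {Δ Λ : List Formula} {y : ℕ} (h : Rep χ ζ Δ) (k : Rep μ ξ Λ) (a : Apart ζ ξ)
    (hy : Fresh y ζ) (hy' : Fresh y ξ) :
    Rep (act (coeval A C) (box χ μ)) (ζ.subst (.app y .var) ++ ξ.subst (.mkc .var y))
      (Δ ++ Λ) := by
  have f : ∀ {ζ : Cx}, Fresh y ζ → Apart ⟨0, [.app y .var, .mkc .var y]⟩ ζ := by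
    intro ζ h
    simpa [apart_iff, Fresh, Cx.mem_labels_mk, Tm.labels] using h
  simpa [Cx.append_def] using
    act_box_rep (coeval_rep A C y) (typed_coeval A C y) h k (f hy) (f hy') a

/-- The composite contains the redex `postp(z ↦ casel M, mkc(x, y))`. Contracting it turns `y(x)`
into `casel M` and restores `caser M`, the two components of `f`. -/
theorem curry_uncurry {A B C : Formula} (f : C ⟶ A ⊗ B) :
    coeval A C ≫ A ◁ Mor.uncurry f = f := by
  refine (sep_two A B).ext ?_
  change act (coeval A C ≫ Mor.tensor (𝟙 A) (Mor.uncurry f)) _ = _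
  rw [act_comp, act_tensor, act_id]
  -- Label `0` is reserved for the binder of the transpose, `1` for the unit.
  obtain ⟨P, M, hf, d⟩ := exists_repBy f (Set.toFinite {0, 1})
  have h₀ : Fresh 0 ⟨P, [M]⟩ := fun h => Set.disjoint_left.1 d h (by simp)
  have h₁ : Fresh 1 ⟨P, [M]⟩ := fun h => Set.disjoint_left.1 d h (by simp)
  have u : Rep (act (Mor.uncurry f) (one B)) (Cx.uncurry 0 ⟨P, [M]⟩) [B] :=
    act_one_rep (hf.uncurry h₀)
  have r := act_coeval_rep (y := 1) (one_rep A) u (apart_of_labels_eq_empty labels_var)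
    (by simp [Fresh, labels_var]) (by
      simp only [Fresh, Cx.mem_labels_uncurry]
      simpa [Fresh] using h₁)
  have fr : ∀ n, Fresh n ⟨P, [M]⟩ →
      Fresh n ((⟨P, [.caser M]⟩ : Cx).cons (.casel M)) := by
    intro n h
    simp [Fresh, Cx.mem_labels_cons, Cx.mem_labels_mk, Tm.labels] at *
    grind
  have e := Eqn.subBeta (κ := ⟨0, []⟩) (M := .var) (ζ := ⟨0, [.var]⟩) (ξ := ⟨P, [.caser M]⟩)
    (L := .casel M) (Γ := []) (Δ := [A]) (Λ := [B]) 1 0 (Typed.var C) (Typed.var A)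
    (Typed.parE_pair (κ := ⟨P, []⟩) hf.typed) (apart_of_labels_eq_empty labels_var)
    (apart_of_labels_eq_empty labels_var) (apart_of_labels_eq_empty labels_var) (by simp)
    (by simp [Fresh, Cx.cons, labels_var]) (by simp [Fresh, labels_var]) (fr 1 h₁)
    (by simp [Fresh, Cx.cons, labels_var]) (by simp [Fresh, labels_var]) (fr 0 h₀)
  refine (r.congr ?_).eq (act_pair_rep hf)
  have e' : Eqn C ⟨(P.map fun R => R.subst (.app 0 (.mkc .var 1))) +
        {.postpone 0 (.casel M) (.mkc .var 1)},
      [.caser (M.subst (.app 0 (.mkc .var 1))), .app 1 .var]⟩ ⟨P, [.caser M, .casel M]⟩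
      [B, A] := by
    simpa [Cx.append_def, Cx.addCtrl, Cx.subst, Tm.subst, Tm.subst_var, add_comm] using e
  simpa [Cx.append_def, Cx.addCtrl, Cx.subst, Tm.subst, Cx.uncurry, Cx.out, Function.comp_def,
    Tm.subst_subst, add_comm] using e'.swap_two

/-- β for par, applied under the binder, reduces the postponed term to `y(x)`. What remains is the
η-expansion of the variable of type `C ∖ A`, cut with `g`. -/
theorem uncurry_curry {A B C : Formula} (g : C.sub A ⟶ B) :
    Mor.uncurry (coeval A C ≫ A ◁ g) = g := by
  obtain ⟨Q, N, hg, d⟩ := exists_repBy g (Set.toFinite {0, 1})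
  have h₀ : Fresh 0 ⟨Q, [N]⟩ := fun h => Set.disjoint_left.1 d h (by simp)
  have h₁ : Fresh 1 ⟨Q, [N]⟩ := fun h => Set.disjoint_left.1 d h (by simp)
  have r : Rep (act (coeval A C ≫ Mor.tensor (𝟙 A) g) (box (one A) (one B)))
      ⟨Q.map fun R => R.subst (.mkc .var 1), [.app 1 .var, N.subst (.mkc .var 1)]⟩ [A, B] := by
    rw [act_comp, act_tensor, act_id]
    simpa [Cx.append_def, Cx.subst, Tm.subst] using
      act_coeval_rep (y := 1) (one_rep A) (act_one_rep hg) (apart_of_labels_eq_empty labels_var)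
        (by simp [Fresh, labels_var]) h₁
  have lab : ∀ n, n ∈ Cx.labels ⟨Q.map fun R => R.subst (.mkc .var 1), [N.subst (.mkc .var 1)]⟩ →
      n ∈ Cx.labels ⟨Q, [N]⟩ ∨ n = 1 := by
    intro n h
    have : n ∈ (Cx.subst ⟨Q, [N]⟩ (.mkc .var 1)).labels := h
    simp [Cx.mem_labels_subst, Tm.labels] at this
    exact this
  have fr : Fresh 0 ⟨Q.map fun R => R.subst (.mkc .var 1), [N.subst (.mkc .var 1)]⟩ := by
    intro h
    rcases lab 0 h with h | h
    · exact h₀ h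
    · simp at h
  have u := (repBy_of_act_pair r).uncurry (z := 0) (by
    simp [Fresh, Cx.mem_labels_mk, Tm.labels] at fr ⊢
    exact fr)
  have t := r.typed
  have k := Eqn.parBeta_pair (κ := ⟨Q.map fun R => R.subst (.mkc .var 1), []⟩) t
  -- Equations reach the locally bound term only through compatibility of subtraction elimination.
  have e := Eqn.subE (κ := ⟨0, []⟩) (κ' := ⟨0, []⟩)
    (ζ := ⟨Q.map fun R : Tm .p => R.subst (.mkc .var 1),
      [.caser (.par (.app 1 .var) (N.subst (.mkc .var 1)))]⟩)
    (ζ' := ⟨Q.map fun R : Tm .p => R.subst (.mkc .var 1), [N.subst (.mkc .var 1)]⟩)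
    (N := .casel (.par (.app 1 .var) (N.subst (.mkc .var 1)))) (N' := .app 1 .var) 0
    (Eqn.refl (Typed.var (C.sub A))) k (apart_of_labels_eq_empty labels_var)
    (apart_of_labels_eq_empty labels_var)
    (by simp [Fresh, Cx.cons, labels_var])
    (by simp [Fresh, Cx.cons, Cx.mem_labels_mk, Tm.labels] at fr ⊢; exact fr)
    (by simp [Fresh, Cx.cons, labels_var])
    (by simp [Fresh, Cx.cons, Cx.mem_labels_mk, Tm.labels] at fr ⊢; exact fr)
  have η := Eqn.subEta (κ := ⟨0, []⟩) 0 1 (Typed.var (C.sub A)) (by simp)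
    (by simp [Fresh, Cx.cons, labels_var]) (by simp [Fresh, Cx.cons, labels_var])
  have c := η.compMulti (Eqn.refl hg.typed)
    (by
      simp only [apart_iff, Fresh] at *
      simp [Cx.addCtrl, Cx.cons, Cx.mem_labels_mk, Tm.labels] at *
      grind)
    (apart_of_labels_eq_empty labels_var)
  refine (u.congr (Eqn.trans ?_ c)).eq ?_
  · simpa [Cx.append_def, Cx.addCtrl, Cx.subst, Tm.subst, Cx.uncurry, Cx.out, Function.comp_def,
      Tm.subst_subst, add_comm, Cx.cons, Cx.comp] using e
  · simpa [Cx.append_def, Cx.subst, Tm.subst, Cx.comp, Cx.out, Cx.cons, Tm.subst_var] using hg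

/-- Transposition as a bijection between sets of morphisms. -/
def curryEquiv (A C B : Formula) : (C.sub A ⟶ B) ≃ (C ⟶ (tensorLeft A).obj B) where
  toFun g := coeval A C ≫ A ◁ g
  invFun f := Mor.uncurry f
  left_inv := uncurry_curry
  right_inv := curry_uncurry

/-- Naturality in the target suffices: it determines the action of `- ∖ A` on morphisms. -/
theorem curryEquiv_naturality (A X Y Y' : Formula) (g : Y ⟶ Y') (h : X.sub A ⟶ Y) :
    curryEquiv A X Y' (h ≫ g) = curryEquiv A X Y h ≫ (tensorLeft A).map g := by
  simp [curryEquiv]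

/-- The syntactic category is left closed. -/
@[reducible] def leftClosed : LeftClosed Formula where
  coexp A := Adjunction.leftAdjointOfEquiv (curryEquiv A) (curryEquiv_naturality A)
  adj A := Adjunction.adjunctionOfEquivLeft (curryEquiv A) (curryEquiv_naturality A)

attribute [local instance] leftClosed

theorem adj_unit_app (A C : Formula) : (LeftClosed.adj A).unit.app C = coeval A C := by
  change (Adjunction.adjunctionOfEquivLeft (curryEquiv A) (curryEquiv_naturality A)).unit.app C = _
  rw [Adjunction.adjunctionOfEquivLeft_unit_app]
  change coeval A C ≫ A ◁ 𝟙 (C.sub A) = _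
  rw [MonoidalCategory.whiskerLeft_id]
  exact Category.comp_id _

theorem adj_homEquiv_symm (A C B : Formula) (f : C ⟶ A ⊗ B) :
    ((LeftClosed.adj A).homEquiv C B).symm f = Mor.uncurry f := by
  rw [Equiv.symm_apply_eq, Adjunction.homEquiv_unit, adj_unit_app]
  exact (curry_uncurry f).symm

theorem adj_counit_app (A C : Formula) :
    (LeftClosed.adj A).counit.app C = Mor.uncurry (𝟙 (A ⊗ C)) := by
  rw [← adj_homEquiv_symm, Adjunction.homEquiv_counit]
  change _ = (LeftClosed.coexp A).map (𝟙 ((tensorLeft A).obj C)) ≫ _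
  rw [CategoryTheory.Functor.map_id, Category.id_comp]

theorem adj_unit_rep (A C : Formula) (y : ℕ) :
    RepBy ((LeftClosed.adj A).unit.app C) ⟨0, [.par (.app y .var) (.mkc .var y)]⟩ := by
  rw [adj_unit_app]
  exact coeval_rep A C y

theorem adj_counit_rep (A C : Formula) (x : ℕ) :
    RepBy ((LeftClosed.adj A).counit.app C)
      ⟨{.postpone x (.casel .var) .var}, [.caser (.app x .var)]⟩ := by
  rw [adj_counit_app]
  have h := (RepBy.id (A ⊗ C)).uncurry (z := x) (by simp [Fresh, labels_var])
  simpa [Cx.uncurry, Cx.out, Cx.addCtrl, Cx.subst, Tm.subst] using h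

/-! ### Interpretation in the syntactic category -/

/-- This needs induction and is not definitional for a variable formula. Succedents are therefore
kept as `interpMap Γ` until the very end, which avoids transport. -/
theorem interp_atom (A : Formula) : A.interp Formula.atom = A := by
  induction A with
  | atom n => rfl
  | bot => rfl
  | par A B ih ih' => exact congrArg₂ Formula.par ih ih'
  | sub A B ih ih' => exact congrArg₂ Formula.sub ih ih'

/-- The interpretation of a list of formulas in the syntactic category, as a list. -/
def interpMap (Γ : List Formula) : List Formula := Γ.map fun A => A.interp Formula.atom

theorem interpMap_eq (Γ : List Formula) : interpMap Γ = Γ := by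
  simp [interpMap, interp_atom]

theorem interpMap_append (Γ Δ : List Formula) :
    interpMap (Γ ++ Δ) = interpMap Γ ++ interpMap Δ := by
  simp [interpMap]

theorem interpMap_cons (A : Formula) (Γ : List Formula) :
    interpMap (A :: Γ) = A.interp Formula.atom :: interpMap Γ := rfl

/-- The generic decomposition of the par of a list of formulas. -/
def elim : (Γ : List Formula) → Multi (interpList Formula.atom Γ)
  | [] => Multi.unit
  | A :: Γ => box (one (A.interp Formula.atom)) (elim Γ)

theorem exists_elim_rep (Γ : List Formula) :
    ∃ κ, Rep (elim Γ) κ (interpMap Γ) ∧ κ.labels = ∅ := by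
  -- Absence of labels comes as part of separation, which `Separates.box` propagates.
  suffices H : ∃ κ, Rep (elim Γ) κ (interpMap Γ) ∧
      Separates (interpList Formula.atom Γ) κ (interpMap Γ) from
    H.imp fun κ h => ⟨h.1, h.2.labels⟩
  induction Γ with
  | nil => exact ⟨_, unit_rep, separates_postp⟩
  | cons A Γ ih =>
    obtain ⟨κ, h, s⟩ := ih
    exact ⟨_, box_rep (one_rep _) h (apart_of_labels_eq_empty labels_var),
      (separates_var _).box s⟩

/-! ### Typing rules applied inside a decomposition -/

namespace Multi

variable {E F G A B C : Formula} {κ ζ : Cx} {Γ Δ : List Formula}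

theorem act_whiskerLeft (A : Formula) (f : E ⟶ F) (χ : Multi A) (μ : Multi F) :
    act (A ◁ f) (box χ μ) = box χ (act f μ) := by
  change act (Mor.tensor (𝟙 A) f) _ = _
  rw [act_tensor, act_id]

theorem act_whiskerRight (A : Formula) (f : E ⟶ F) (χ : Multi F) (μ : Multi A) :
    act (f ▷ A) (box χ μ) = box (act f χ) μ := by
  change act (Mor.tensor f (𝟙 A)) _ = _
  rw [act_tensor, act_id]

/-- Categorical counterpart of a cut beside other conclusions. A representative `P | L` of `f`
exhibits `κ, M` as `casel L` beside `ξ[caser L]`, up to equations; replacing the variable in the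
first slot by `ζ` is then compatibility with substitution. -/
theorem act_cut_rep {f : E ⟶ A.par F} {χ : Multi F} {μ : Multi A} {M : Tm .m}
    (h : Rep (act f (box (one A) χ)) (κ.cons M) (A :: Γ)) (k : Rep μ ζ Δ)
    (a : Apart (κ.cons M) ζ) :
    Rep (act f (box μ χ)) (ζ.subst M ++ κ) (Δ ++ Γ) := by
  obtain ⟨ξ, Λ, hξ, dξ⟩ := exists_rep χ ζ.finite_labels
  obtain ⟨P, L, hf, df⟩ := exists_repBy f (ζ.finite_labels.union ξ.finite_labels)
  rw [Set.disjoint_union_right] at df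
  have l := act_rep hf (box_rep (one_rep A) hξ (apart_of_labels_eq_empty labels_var)) (by
    have := df.2
    simp only [Set.disjoint_left] at this
    simp [apart_iff, Cx.mem_labels_append, Cx.mem_labels_subst, Tm.labels, labels_var]
    grind)
  -- Classes remember their succedents.
  have hΓ : Λ = Γ := by simpa using l.out_eq h
  subst hΓ
  have e := l.eqn h
  have hL : ∀ n, n ∈ L.labels → n ∈ Cx.labels ⟨P, [L]⟩ := fun n h => Or.inr ⟨L, by simp, h⟩
  have hP : ∀ n, n ∈ Cx.labels ⟨P, []⟩ → n ∈ Cx.labels ⟨P, [L]⟩ := fun n h => by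
    simp only [Cx.mem_labels_mk] at h ⊢; grind
  have e' : Eqn E ((ξ.subst (.caser L) ++ ⟨P, []⟩).cons (.casel L)) (κ.cons M) (A :: Λ) := by
    simpa [Cx.comp_mk, Cx.append_def, Cx.subst, Tm.subst, Cx.cons, Tm.subst_subst,
      Function.comp_def] using e
  have s := Eqn.subst e' (Eqn.refl k.typed) (by
    have h₁ := df.1
    simp only [Set.disjoint_left] at h₁ dξ
    simp only [apart_iff, Cx.mem_labels_append, Cx.mem_labels_cons, Cx.mem_labels_subst, Tm.labels]
    grind) a
  have r := act_rep hf (box_rep k hξ (Disjoint.symm dξ)) (by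
    have h₁ := df.1
    have h₂ := df.2
    simp only [Set.disjoint_left] at h₁ h₂
    simp [apart_iff, Cx.mem_labels_append, Cx.mem_labels_subst, Tm.labels]
    grind)
  refine r.congr ?_
  simpa [Cx.comp_mk, Cx.append_def, Cx.subst, Tm.subst, Tm.subst_subst, Function.comp_def,
    add_assoc] using s

theorem act_parI_rep {f : E ⟶ F} {χ μ : Multi F} {M N M' N' : Tm .m}
    (h : Rep χ ((ζ.cons N).cons M) (A :: B :: Γ))
    (k : Rep (act f χ) ((κ.cons N').cons M') (A :: B :: Γ))
    (h' : Rep μ (ζ.cons (.par M N)) (A.par B :: Γ)) :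
    Rep (act f μ) (κ.cons (.par M' N')) (A.par B :: Γ) := by
  obtain ⟨P, L, hf, d⟩ := exists_repBy f (Cx.finite_labels ((ζ.cons N).cons M))
  simp only [Set.disjoint_left, Cx.mem_labels_cons] at d
  have l := (act_rep hf h (by simp only [apart_iff, Cx.mem_labels_cons]; exact d)).eqn k
  have r := act_rep hf h' (by
    simp only [apart_iff, Cx.mem_labels_cons, Tm.labels, Set.mem_union]; grind)
  refine r.congr ?_
  exact Eqn.parI (κ := ζ.subst L ++ ⟨P, []⟩) l

/-- The transpose is defined with projections of a single term, whereas the calculus postpones an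
arbitrary `N`. Compatibility of subtraction elimination passes from one to the other. -/
theorem act_uncurry_rep {f : C ⟶ A ⊗ B} {χ : Multi B} {N : Tm .m} {x : ℕ}
    (h : Rep (act f (box (one A) χ)) (ζ.cons N) (A :: Δ)) (hx : Fresh x (ζ.cons N)) :
    Rep (act (Mor.uncurry f) χ) ((ζ.subst (.app x .var)).addCtrl (.postpone x N .var)) Δ := by
  obtain ⟨ξ, Λ, hξ, dξ⟩ := exists_rep χ (Set.finite_singleton x)
  obtain ⟨P, L, hf, df⟩ := exists_repBy f ((Set.finite_singleton x).union ξ.finite_labels)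
  rw [Set.disjoint_union_right] at df
  obtain ⟨hx', df⟩ := df
  rw [Set.disjoint_singleton_right] at hx' dξ
  simp only [Set.disjoint_left] at df
  have l := act_rep hf (box_rep (one_rep A) hξ (apart_of_labels_eq_empty labels_var)) (by
    simp [apart_iff, Cx.mem_labels_append, Cx.mem_labels_subst, Tm.labels, labels_var]
    grind)
  have hΛ : Λ = Δ := by simpa using l.out_eq h
  subst hΛ
  have e : Eqn C ((ξ.subst (.caser L) ++ ⟨P, []⟩).cons (.casel L)) (ζ.cons N) (A :: Λ) := by
    simpa [Cx.comp_mk, Cx.append_def, Cx.subst, Tm.subst, Cx.cons, Tm.subst_subst,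
      Function.comp_def] using l.eqn h
  have hL : ∀ n, n ∈ L.labels → n ∈ Cx.labels ⟨P, [L]⟩ := fun n h => Or.inr ⟨L, by simp, h⟩
  have hP : ∀ n, n ∈ Cx.labels ⟨P, []⟩ → n ∈ Cx.labels ⟨P, [L]⟩ := fun n h => by
    simp only [Cx.mem_labels_mk] at h ⊢; grind
  have s := Eqn.subE (κ := ⟨0, []⟩) (κ' := ⟨0, []⟩) x (Eqn.refl (Typed.var (C.sub A))) e
    (apart_of_labels_eq_empty labels_var) (apart_of_labels_eq_empty labels_var)
    (by simp [Fresh, Cx.cons, labels_var])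
    (by
      simp only [Fresh, Cx.mem_labels_append, Cx.mem_labels_cons, Cx.mem_labels_subst, Tm.labels]
      grind)
    (by simp [Fresh, Cx.cons, labels_var]) hx
  have r := act_rep (hf.uncurry hx') hξ (by
    simp only [apart_iff, Cx.mem_labels_uncurry]
    grind)
  refine r.congr ?_
  simpa [Cx.comp, Cx.out, Cx.uncurry, Cx.append_def, Cx.addCtrl, Cx.subst, Tm.subst,
    Tm.subst_subst, Function.comp_def] using s

end Multi

/-- `join` is built from associators and one left unitor, which rebracket the boxes and insert the
final `unit`. -/
theorem act_join (Γ Δ : List Formula) :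
    act (join Formula.atom Γ Δ) (elim (Γ ++ Δ)) = box (elim Γ) (elim Δ) := by
  induction Γ with
  | nil => exact act_leftUnitor (elim Δ)
  | cons A Γ ih =>
    refine (act_comp _ _ _).trans ?_
    refine (congrArg _ ((act_whiskerLeft _ _ _ _).trans (congrArg _ ih))).trans ?_
    exact act_assoc _ _ _

/-- The two representatives differ by one adjacent transposition, the form in which `act_exch_rep`
transfers the swap to an arbitrary derivation. -/
theorem act_swapAt (A B : Formula) (Δ Γ : List Formula) :
    ∃ (P : Multiset (Tm .p)) (Ms Ns : List (Tm .m)) (M N : Tm .m), Ms.length = Γ.length ∧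
      Cx.labels ⟨P, Ms ++ N :: M :: Ns⟩ = ∅ ∧
      Rep (elim (Γ ++ A :: B :: Δ)) ⟨P, Ms ++ M :: N :: Ns⟩ (interpMap (Γ ++ A :: B :: Δ)) ∧
      Rep (act (swapAt Formula.atom A B Δ Γ) (elim (Γ ++ B :: A :: Δ)))
        ⟨P, Ms ++ N :: M :: Ns⟩ (interpMap (Γ ++ B :: A :: Δ)) := by
  induction Γ with
  | nil =>
    obtain ⟨ζ, hζ, lζ⟩ := exists_elim_rep Δ
    have e := box_rep (one_rep (A.interp Formula.atom))
      (box_rep (one_rep (B.interp Formula.atom)) hζ (apart_of_labels_eq_empty labels_var))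
      (apart_of_labels_eq_empty labels_var)
    have lp : Cx.labels ⟨0, [.casel .var, .caser .var]⟩ = ∅ := by
      ext; simp [Cx.mem_labels_mk, Tm.labels]
    have lp' : Cx.labels ⟨0, [.caser .var, .casel .var]⟩ = ∅ := by
      ext; simp [Cx.mem_labels_mk, Tm.labels]
    have b := box_rep (box_one_one_rep (A.interp Formula.atom) (B.interp Formula.atom)) hζ
      (apart_of_labels_eq_empty lp)
    have b' := box_rep (act_braid_one (A.interp Formula.atom) (B.interp Formula.atom)) hζ
      (apart_of_labels_eq_empty lp')
    refine ⟨(ζ.subst (.caser (.caser .var))).ctrl, [], (ζ.subst (.caser (.caser .var))).tms,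
      .casel .var, .casel (.caser .var), rfl, ?_, ?_, ?_⟩
    · ext n
      have := Cx.mem_labels_subst (n := n) (κ := ζ) (T := .caser (.caser .var))
      simp only [lζ, Tm.labels] at this
      simp only [Cx.labels, Set.mem_ofPred_eq] at this
      simp [Cx.mem_labels_mk, Tm.labels]
      grind
    · simp [Cx.append_def, Cx.subst, Tm.subst, Tm.subst_subst, Function.comp_def] at e ⊢
      exact e
    · have x := act_exch_rep (f := assocInv _ _ _) (Ms := []) (Ms' := []) (Γ := []) rfl rfl b
        (by
          rw [act_assocInv]
          simpa [Cx.append_def, Cx.subst, Tm.subst, Tm.subst_subst, Function.comp_def] using e) b'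
      -- Computed from the inside: the associator isolates the first two factors and the symmetry
      -- acts on them. The remaining inverse associator is handled by `x`.
      have w : act (swapAt Formula.atom A B Δ []) (elim ([] ++ B :: A :: Δ)) =
          act (assocInv _ _ _) (box (act (braidHom _ _) (box (one _) (one _))) (elim Δ)) := by
        refine (act_comp _ _ _).trans (congrArg _ ?_)
        refine (act_comp _ _ _).trans ?_
        refine (congrArg _ (act_assoc _ _ _)).trans ?_
        exact act_whiskerRight _ _ _ _
      rw [w]
      simp [Cx.subst] at x ⊢
      exact x
  | cons D Γ ih =>
    obtain ⟨P, Ms, Ns, M, N, hl, lab, h, h'⟩ := ih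
    have e := box_rep (one_rep (D.interp Formula.atom)) h (apart_of_labels_eq_empty labels_var)
    have e' := box_rep (one_rep (D.interp Formula.atom)) h' (apart_of_labels_eq_empty labels_var)
    refine ⟨P.map fun R => R.subst (.caser .var),
      .casel .var :: Ms.map fun R => R.subst (.caser .var),
      Ns.map fun R => R.subst (.caser .var), M.subst (.caser .var), N.subst (.caser .var),
      by simpa using hl, ?_, ?_, ?_⟩
    · have : Cx.labels ((⟨0, [.casel .var]⟩ : Cx) ++
          Cx.subst ⟨P, Ms ++ N :: M :: Ns⟩ (.caser .var)) = ∅ := by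
        ext n
        rw [Cx.mem_labels_append, Cx.mem_labels_subst, lab]
        simp [Cx.mem_labels_mk, Tm.labels]
      simpa [Cx.append_def, Cx.subst] using this
    · simp [Cx.append_def, Cx.subst, Tm.subst] at e ⊢
      exact e
    · have w := act_whiskerLeft (D.interp Formula.atom) (swapAt Formula.atom A B Δ Γ)
        (one (D.interp Formula.atom)) (elim (Γ ++ B :: A :: Δ))
      change Rep (act (D.interp Formula.atom ◁ swapAt Formula.atom A B Δ Γ)
        (box (one (D.interp Formula.atom)) (elim (Γ ++ B :: A :: Δ)))) _ _
      rw [w]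
      simp [Cx.append_def, Cx.subst, Tm.subst] at e' ⊢
      exact e'

/-- Ensures that ⊥ can always be connected to some member of a typed context. Cut and par
elimination inherit a term from a right premise. -/
theorem Typed.nonempty {E : Formula} {κ : Cx} {Γ : List Formula} (h : Typed E κ Γ) :
    ∃ (s : Srt) (R : Tm s), κ.Mem R := by
  suffices H : κ.ctrl ≠ 0 ∨ κ.tms ≠ [] by
    rcases H with H | H
    · obtain ⟨R, hR⟩ := Multiset.exists_mem_of_ne_zero H
      exact ⟨.p, R, hR⟩
    · obtain ⟨R, hR⟩ := List.exists_mem_of_ne_nil _ H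
      exact ⟨.m, R, hR⟩
  obtain ⟨d⟩ := h
  induction d with
  | cut _ _ _ _ ih =>
    simp only [Cx.append_def, Cx.subst, ne_eq, add_eq_zero, Multiset.map_eq_zero,
      List.append_eq_nil_iff, List.map_eq_nil_iff]
    tauto
  | parE _ _ _ _ _ _ _ ih _ =>
    simp only [Cx.append_def, Cx.subst, ne_eq, add_eq_zero, Multiset.map_eq_zero,
      List.append_eq_nil_iff, List.map_eq_nil_iff]
    tauto
  | _ => simp [Cx.cons, Cx.addCtrl]

/-- The rule for subtraction introduction lists `C ∖ A` first, whereas the unit of the adjunction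
puts it second; the symmetry reconciles the two. -/
theorem act_coeval_braid_rep {A C : Formula} {χ : Multi (C.sub A)} {μ : Multi A} {ζ ξ : Cx}
    {Δ Λ : List Formula} {y : ℕ} (h : Rep χ ζ Δ) (k : Rep μ ξ Λ) (a : Apart ζ ξ)
    (hy : Fresh y ζ) (hy' : Fresh y ξ) :
    Rep (act (coeval A C ≫ braidHom A (C.sub A)) (box χ μ))
      (ζ.subst (.mkc .var y) ++ ξ.subst (.app y .var)) (Δ ++ Λ) := by
  have x := act_exch_rep (f := coeval A C) (Ms := []) (Ms' := []) (Γ := []) (Δ := [])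
    (Ns := []) (Ns' := []) rfl rfl (box_one_one_rep A (C.sub A))
    (by
      simpa [Cx.append_def, Cx.subst, Tm.subst] using
        act_coeval_rep (y := y) (one_rep A) (one_rep (C.sub A))
          (apart_of_labels_eq_empty labels_var) (by simp [Fresh, labels_var])
          (by simp [Fresh, labels_var])) (act_braid_one A (C.sub A))
  have r : RepBy (coeval A C ≫ braidHom A (C.sub A)) ⟨0, [.par (.mkc .var y) (.app y .var)]⟩ :=
    repBy_of_act_pair (by rw [act_comp]; exact x)
  have f : ∀ {ζ : Cx}, Fresh y ζ → Apart ⟨0, [.mkc .var y, .app y .var]⟩ ζ := by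
    intro ζ h
    simpa [apart_iff, Fresh, Cx.mem_labels_mk, Tm.labels] using h
  simpa [Cx.append_def] using
    act_box_rep r (typed_coeval A C y).swap_two h k (f hy) (f hy') a

/-- In the syntactic category, a derivation is interpreted by the typed term that it derives. -/
theorem interp_rep {E : Formula} {κ : Cx} {Γ : List Formula} (d : Der E κ Γ) :
    Rep (act (d.interp Formula.atom) (elim Γ)) κ (interpMap Γ) := by
  induction d with
  | ax A =>
    have := act_rightUnitorInv (one (A.interp Formula.atom))
    change Rep (act (rightUnitorInv _) (box (one (A.interp Formula.atom)) unit)) _ _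
    rw [this]
    exact one_rep _
  | @exch E P Ms Ns M N Γ Δ A B hlen d ih =>
    obtain ⟨Q, Ls, Ks, L, K, hl, -, h, h'⟩ := act_swapAt A B Δ Γ
    rw [Der.interp, act_comp]
    simp only [interpMap_append, interpMap_cons] at h h' ih ⊢
    exact act_exch_rep (by simpa [interpMap] using hl) (by simpa [interpMap] using hlen) h ih h'
  | @cut E A κ ζ M Γ Δ d e h ihd ihe =>
    have w : act ((Der.cut d e h).interp Formula.atom) (elim (Δ ++ Γ)) =
        act (d.interp Formula.atom) (box (act (e.interp Formula.atom) (elim Δ)) (elim Γ)) := by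
      refine (act_comp _ _ _).trans (congrArg _ ?_)
      refine (act_comp _ _ _).trans ?_
      rw [act_join]
      exact act_whiskerRight _ _ _ _
    rw [w, interpMap_append]
    exact act_cut_rep ihd ihe h
  | @botI E κ Γ s R d hR ih =>
    obtain ⟨ζ, hζ, lζ⟩ := exists_elim_rep Γ
    obtain ⟨P, L, hf, -⟩ := exists_repBy (d.interp Formula.atom) Set.finite_empty
    -- The interpretation connects ⊥ to the output `L` of a representative of `d`, whatever `R` was.
    have l := act_box_rep (leftUnitorInv_rep (interpList Formula.atom Γ)) (typed_conn_pair _)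
      (one_rep .bot) hζ (apart_of_labels_eq_empty labels_var).symm
      (apart_of_labels_eq_empty lζ).symm (apart_of_labels_eq_empty labels_var)
    have r := act_rep hf l (by
      refine (apart_of_labels_eq_empty ?_).symm
      ext; simp [Cx.mem_labels_append, Cx.mem_labels_subst, lζ, labels_var, Cx.mem_labels_mk,
        Tm.labels])
    have r' := act_rep hf hζ (apart_of_labels_eq_empty lζ).symm
    have w : act ((Der.botI d hR).interp Formula.atom) (elim (.bot :: Γ)) =
        act (d.interp Formula.atom) (act (leftUnitorInv _) (box (one .bot) (elim Γ))) :=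
      act_comp _ _ _
    rw [w]
    have c : Rep (act (d.interp Formula.atom) (act (leftUnitorInv _) (box (one .bot) (elim Γ))))
        ((Cx.comp ⟨P, [L]⟩ ζ).cons (.conn L)) (.bot :: interpMap Γ) := by
      simpa [Cx.comp_mk, Cx.append_def, Cx.subst, Tm.subst, Cx.cons, Tm.subst_var] using r
    -- `L` need not be a member of the decomposed context. The connection is rewired to some member
    -- `R'`, and compatibility along the induction hypothesis then replaces `R'` by `R`.
    obtain ⟨s', R', hR'⟩ := r'.typed.nonempty
    exact c.congr ((Eqn.rewire r'.typed c.typed (r'.typed.botI hR')).trans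
      (Eqn.botI (r'.eqn ih) hR' hR))
  | botE =>
    change Rep (act (𝟙 Formula.bot) unit) _ _
    rw [act_id]
    exact unit_rep
  | @subI E C D κ ζ M Γ Δ y d e h hy hy' ihd ihe =>
    have w : act ((Der.subI y d e h hy hy').interp Formula.atom) (elim (C.sub D :: (Δ ++ Γ))) =
        act (d.interp Formula.atom) (box (act
          (coeval (D.interp Formula.atom) (C.interp Formula.atom) ≫ braidHom _ _)
          (box (one ((C.sub D).interp Formula.atom))
            (act (e.interp Formula.atom) (elim Δ)))) (elim Γ)) := by
      refine (act_comp _ _ _).trans (congrArg _ ?_)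
      refine (act_comp _ _ _).trans ?_
      refine (congrArg _ ((act_comp _ _ _).trans (congrArg _
        ((act_whiskerLeft _ _ _ _).trans (congrArg _ (act_join Δ Γ)))))).trans ?_
      refine (congrArg _ (act_assoc _ _ _)).trans ?_
      refine (act_whiskerRight _ _ _ _).trans ?_
      refine congrArg (fun χ => box χ (elim Γ)) ?_
      -- Naturality moves the right premise past the symmetry, so that it acts on one component of a
      -- box.
      rw [adj_unit_app, BraidedCategory.braiding_naturality_left, ← Category.assoc]
      refine (act_comp _ _ _).trans ?_
      exact congrArg _ (act_whiskerLeft _ _ _ _)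
    rw [w]
    have k := act_coeval_braid_rep (y := y) (one_rep ((C.sub D).interp Formula.atom)) ihe
      (apart_of_labels_eq_empty labels_var) (by simp [Fresh, labels_var]) hy'
    have c := act_cut_rep ihd k (by
      have h₁ := apart_iff.1 h
      have h₂ : y ∉ (κ.cons M).labels := hy
      simp only [apart_iff, Cx.mem_labels_append, Cx.mem_labels_subst, Tm.labels,
        labels_var, Set.mem_insert_iff, Set.mem_empty_iff_false]
      grind)
    simp [Cx.append_def, Cx.subst, Tm.subst, Tm.subst_subst, Function.comp_def, Cx.cons,
      interpMap_append, interpMap_cons] at c ⊢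
    exact c
  | @subE E C D κ ζ M N Γ Δ x d e h hx hx' ihd ihe =>
    have w : act ((Der.subE x d e h hx hx').interp Formula.atom) (elim (Δ ++ Γ)) =
        act (d.interp Formula.atom)
          (box (act (Mor.uncurry (e.interp Formula.atom)) (elim Δ)) (elim Γ)) := by
      refine (act_comp _ _ _).trans (congrArg _ ?_)
      refine (act_comp _ _ _).trans ?_
      rw [act_join]
      refine (act_whiskerRight _ _ _ _).trans ?_
      exact congrArg (fun g => box (act g (elim Δ)) (elim Γ))
        (adj_homEquiv_symm _ _ _ (e.interp Formula.atom))
    rw [w]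
    -- Elimination at a general `M` is elimination at a variable followed by a cut.
    have c := act_cut_rep ihd (act_uncurry_rep ihe hx') (by
      have h₁ := apart_iff.1 h
      have h₂ : x ∉ (κ.cons M).labels := hx
      simp only [Cx.mem_labels_cons (κ := ζ)] at h₁
      simp only [apart_iff, Cx.mem_labels_addCtrl, Cx.mem_labels_subst, Tm.labels,
        Set.mem_insert_iff, Set.mem_union, Set.mem_empty_iff_false]
      grind)
    simp [Cx.append_def, Cx.subst, Tm.subst, Tm.subst_subst, Function.comp_def, Cx.addCtrl,
      interpMap_append] at c ⊢
    exact c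
  | @parI E A B κ M N Γ d ih =>
    obtain ⟨ζ, hζ, lζ⟩ := exists_elim_rep Γ
    have l := act_box_rep (assocInv_rep (A.interp Formula.atom) (B.interp Formula.atom)
      (interpList Formula.atom Γ)) (typed_assoc_inv_pair _ _ _)
      (one_rep ((A.par B).interp Formula.atom)) hζ
      (apart_of_labels_eq_empty labels_var).symm (apart_of_labels_eq_empty lζ).symm
      (apart_of_labels_eq_empty labels_var)
    have e := box_rep (one_rep (A.interp Formula.atom))
      (box_rep (one_rep (B.interp Formula.atom)) hζ (apart_of_labels_eq_empty labels_var))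
      (apart_of_labels_eq_empty labels_var)
    have w : act ((Der.parI d).interp Formula.atom) (elim (A.par B :: Γ)) =
        act (d.interp Formula.atom) (act (assocInv _ _ _)
          (box (one ((A.par B).interp Formula.atom)) (elim Γ))) := act_comp _ _ _
    rw [w]
    -- The inverse associator turns the decomposition of `A, B, Γ` into that of `A ⅋ B, Γ` by
    -- pairing its first two terms.
    refine act_parI_rep (χ := elim (A :: B :: Γ)) (ζ := ζ.subst (.caser (.caser .var)))
      (M := .casel .var) (N := .casel (.caser .var)) ?_ ih ?_
    · simp [Cx.append_def, Cx.subst, Tm.subst, Tm.subst_subst, Function.comp_def, Cx.cons] at e ⊢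
      exact e
    · simp [Cx.append_def, Cx.subst, Tm.subst, Cx.cons] at l ⊢
      exact l
  | @parE E A B κ ζ ξ M Γ Δ Λ d e e' h₁ h₂ h₃ ihd ihe ihe' =>
    have w : act ((Der.parE d e e' h₁ h₂ h₃).interp Formula.atom) (elim (Δ ++ (Λ ++ Γ))) =
        act (d.interp Formula.atom) (box (box (act (e.interp Formula.atom) (elim Δ))
          (act (e'.interp Formula.atom) (elim Λ))) (elim Γ)) := by
      refine (act_comp _ _ _).trans (congrArg _ ?_)
      refine (act_comp _ _ _).trans ?_
      refine (congrArg _ ((act_comp _ _ _).trans (congrArg _ ((act_comp _ _ _).trans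
        (congrArg _ (act_join Δ (Λ ++ Γ))))))).trans ?_
      refine (congrArg _ (congrArg _ ((act_whiskerLeft _ _ _ _).trans
        (congrArg _ (act_join Λ Γ))))).trans ?_
      refine (congrArg _ (act_assoc _ _ _)).trans ?_
      refine (act_whiskerRight _ _ _ _).trans ?_
      exact congrArg (fun χ => box χ (elim Γ)) (act_tensor _ _ _ _)
    rw [w]
    have c := act_cut_rep ihd (box_rep ihe ihe' h₃) (by
      have k₁ := apart_iff.1 h₁
      have k₂ := apart_iff.1 h₂
      simp only [apart_iff, Cx.mem_labels_append, Cx.mem_labels_subst, Tm.labels,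
        Set.mem_empty_iff_false]
      grind)
    simp [Cx.append_def, Cx.subst, Tm.subst, Tm.subst_subst, Function.comp_def,
      interpMap_append, add_assoc] at c ⊢
    exact c

/-- Equal morphisms act equally on `elim Γ`, and both typed terms represent the resulting class. -/
theorem Der.eqn_of_interp_eq {E : Formula} {κ κ' : Cx} {Γ : List Formula} {d : Der E κ Γ}
    {d' : Der E κ' Γ} (h : d.interp Formula.atom = d'.interp Formula.atom) : Eqn E κ κ' Γ := by
  have e := interp_rep d
  rw [h] at e
  have := e.eqn (interp_rep d')
  rwa [interp_atom, interpMap_eq] at this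

end CoILL

open CoILL

/-- The syntactic category is a symmetric monoidal left-closed category, with the structure given
by the connectives and the indicated typed terms; and the calculus is complete: two typed terms in
context whose derivations have equal interpretations in every symmetric monoidal left-closed
category are equal by derivable equations in context. -/
theorem mainTheorem2 :
    (∃ (_ : MonoidalCategory Formula) (_ : SymmetricCategory Formula) (_ : LeftClosed Formula),
      (∀ A B : Formula, A ⊗ B = Formula.par A B) ∧
      𝟙_ Formula = Formula.bot ∧
      (∀ A C : Formula, (LeftClosed.coexp A).obj C = Formula.sub C A) ∧
      (∀ (A A' B B' : Formula) (f : A ⟶ A') (g : B ⟶ B') (κ ζ : Cx),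
        RepBy f κ → RepBy g ζ → Apart κ ζ →
        RepBy (f ⊗ₘ g)
          ⟨(κ.subst (.casel .var)).ctrl + (ζ.subst (.caser .var)).ctrl,
            [.par (κ.subst (.casel .var)).out (ζ.subst (.caser .var)).out]⟩) ∧
      (∀ A B C : Formula, RepBy (α_ A B C).hom
        ⟨0, [.par (.casel (.casel .var)) (.par (.caser (.casel .var)) (.caser .var))]⟩) ∧
      (∀ A : Formula, RepBy (λ_ A).hom ⟨{.postp (.casel .var)}, [.caser .var]⟩) ∧
      (∀ A : Formula, RepBy (ρ_ A).hom ⟨{.postp (.caser .var)}, [.casel .var]⟩) ∧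
      (∀ A B : Formula, RepBy (β_ A B : A ⊗ B ≅ B ⊗ A).hom ⟨0, [.par (.caser .var) (.casel .var)]⟩) ∧
      (∀ (A C : Formula) (y : ℕ), RepBy ((LeftClosed.adj A).unit.app C)
        ⟨0, [.par (.app y .var) (.mkc .var y)]⟩) ∧
      (∀ (A C : Formula) (x : ℕ), RepBy ((LeftClosed.adj A).counit.app C)
        ⟨{.postpone x (.casel .var) .var}, [.caser (.app x .var)]⟩)) ∧
    (∀ (E : Formula) (κ κ' : Cx) (Γ : List Formula) (d : Der E κ Γ) (d' : Der E κ' Γ),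
      (∀ (C : Type) [Category.{0} C] [MonoidalCategory C] [SymmetricCategory C] [LeftClosed C]
        (v : ℕ → C), d.interp v = d'.interp v) →
      Eqn E κ κ' Γ) := by
  refine ⟨⟨monoidal, symmetric, leftClosed, fun _ _ => rfl, rfl, fun _ _ => rfl,
    fun _ _ _ _ _ _ _ _ hf hg a => hf.tensor hg a, assocHom_rep, leftUnitorHom_rep,
    rightUnitorHom_rep, braidHom_rep, adj_unit_rep, adj_counit_rep⟩, fun _ _ _ _ d d' h => ?_⟩
  -- The hypothesis is needed only for the term model, with each atom interpreted by itself.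
  exact Der.eqn_of_interp_eq (@h Formula _ monoidal symmetric leftClosed Formula.atom)
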